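/- **Theorem 1 (VSP prior).** Let $q\in[0,1]$. For a finite nonempty set $o$ of actors (for example any nonempty $o\subseteq[n]$), let $\mathcal V_o$ be the set of vertex-series-parallel partial orders (VSPs) with ground set $o$: the smallest class of strict partial orders that contains the orders on one actor and is closed under series composition $h_1\otimes h_2$ (all of $h_1$ above all of $h_2$) and parallel composition $h_1\oplus h_2$ (no relations between $h_1$ and $h_2$) of orders with disjoint ground sets. Let $\mathcal T_o$ be the set of binary decomposition trees (BDTs) on $o$: rooted binary trees whose leaves are labelled bijectively by $o$ and whose internal nodes have type $S$ or $P$, where at each $S$-node one of the two children is designated the upper child and the children of $P$-nodes are unordered. A BDT $t$ represents the VSP $v(t)$ obtained by merging the two subtrees of each $S$-node in series (the upper child's on top) and those of each $P$-node in parallel. Let $S(t)$ be the number of $S$-nodes of $t$. The prior on $\mathcal T_o$ takes a uniformly distributed binary tree topology with leaves distinguished by $o$, gives each internal node independently the type $S$ with probability $q$ and $P$ with probability $1-q$, and chooses the upper child of each $S$-node by a fair coin; the prior on $\mathcal V_o$ is its image under $t\mapsto v(t)$. With $n=|o|$, the number of topologies is $(2n-3)!!$ (with $(-1)!!=1$),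 so $$\pi_{\mathcal T_o}(t\mid q)=\frac{1}{(2n-3)!!}\Big(\frac q2\Big)^{S(t)}(1-q)^{n-1-S(t)},\qquad \pi_{\mathcal V_o}(v\mid q)=\sum_{t\in\mathcal T_o,\ v(t)=v}\pi_{\mathcal T_o}(t\mid q).$$ Then these are probability distributions, the topology of $t\sim\pi_{\mathcal T_o}(\cdot\mid q)$ is uniform, and: (i) The family $\pi_{\mathcal V_o}(\cdot\mid q)$ is marginally consistent (projective): for all finite sets $\emptyset\ne o\subseteq\tilde o$ and all $w\in\mathcal V_o$, $$\pi_{\mathcal V_o}(w\mid q)=\sum_{v\in\mathcal V_{\tilde o},\ v[o]=w}\pi_{\mathcal V_{\tilde o}}(v\mid q),$$ where $v[o]$ is the restriction of $v$ to $o$. (ii) Every $v\in\mathcal V_o$ is represented by some BDT, and for every BDT $t$ with $v(t)=v$, $$\pi_{\mathcal V_o}(v\mid q)=\pi_{\mathcal T_o}(t\mid q)\ \prod_{C\ P\text{-cluster of }t}(2|C|-1)!!\ \prod_{C\ S\text{-cluster of }t}\mathcal C_{|C|},\qquad \mathcal C_s=\frac1{s+1}\binom{2s}{s},$$ where a $P$-cluster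 (respectively $S$-cluster) of $t$ is a maximal set of internal nodes of type $P$ (respectively $S$) connected by edges of $t$. -/

import Mathlib

namespace VSPPrior

/-! ### Relations on a ground set, series and parallel composition, VSPs -/

/-- A binary relation `above` (written `i ≻ j` in the mathematics) together with a finite ground
set of actors.  The partial orders of interest are the ones singled out by `IsVSP`. -/
@[ext]
structure GroundRel (α : Type*) where
  ground : Finset α
  above : α → α → Prop

namespace GroundRel

variable {α : Type*} [DecidableEq α]

/-- The order with ground set `{a}`. -/
def single (a : α) : GroundRel α := ⟨{a}, fun _ _ => False⟩

/-- `h₁ ⊗ h₂`: everything in `h₁` is put above everything in `h₂`. -/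
def series (h₁ h₂ : GroundRel α) : GroundRel α where
  ground := h₁.ground ∪ h₂.ground
  above i j := h₁.above i j ∨ h₂.above i j ∨ (i ∈ h₁.ground ∧ j ∈ h₂.ground)

/-- `h₁ ⊕ h₂`: no relations between `h₁` and `h₂`. -/
def parallel (h₁ h₂ : GroundRel α) : GroundRel α where
  ground := h₁.ground ∪ h₂.ground
  above i j := h₁.above i j ∨ h₂.above i j

/-- The sub-order `h[o]`. -/
def restrict (h : GroundRel α) (o : Finset α) : GroundRel α where
  ground := h.ground ∩ o
  above i j := h.above i j ∧ i ∈ o ∧ j ∈ o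

end GroundRel

/-- Vertex-series-parallel orders: the smallest class containing the orders on one actor and closed
under series and parallel composition of orders with disjoint ground sets. -/
inductive IsVSP {α : Type*} [DecidableEq α] : GroundRel α → Prop
  | single (a : α) : IsVSP (GroundRel.single a)
  | series {h₁ h₂ : GroundRel α} (hd : Disjoint h₁.ground h₂.ground)
      (v₁ : IsVSP h₁) (v₂ : IsVSP h₂) : IsVSP (h₁.series h₂)
  | parallel {h₁ h₂ : GroundRel α} (hd : Disjoint h₁.ground h₂.ground)
      (v₁ : IsVSP h₁) (v₂ : IsVSP h₂) : IsVSP (h₁.parallel h₂)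

theorem IsVSP.supp {α : Type*} [DecidableEq α] {h : GroundRel α} (hv : IsVSP h) :
    ∀ i j, h.above i j → i ∈ h.ground ∧ j ∈ h.ground := by
  induction hv with
  | single a => intro i j hij; exact hij.elim
  | series hd v₁ v₂ ih₁ ih₂ =>
    intro i j hij
    simp only [GroundRel.series, Finset.mem_union] at hij ⊢
    grind
  | parallel hd v₁ v₂ ih₁ ih₂ =>
    intro i j hij
    simp only [GroundRel.parallel, Finset.mem_union] at hij ⊢
    grind

/-- A VSP is indeed a (strict) partial order on its ground set. -/
theorem IsVSP.isStrictOrder {α : Type*} [DecidableEq α] {h : GroundRel α} (hv : IsVSP h) :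
    IsStrictOrder α h.above := by
  suffices H : (∀ i, ¬ h.above i i) ∧ ∀ i j k, h.above i j → h.above j k → h.above i k from
    { irrefl := H.1, trans := H.2 }
  induction hv with
  | single a => exact ⟨fun _ h => h, fun _ _ _ h _ => h⟩
  | series hd v₁ v₂ ih₁ ih₂ =>
    have s₁ := v₁.supp
    have s₂ := v₂.supp
    have d : ∀ i, i ∈ _ → i ∉ _ := fun i hi => Finset.disjoint_left.1 hd hi
    simp only [GroundRel.series]
    constructor
    · grind
    · grind
  | parallel hd v₁ v₂ ih₁ ih₂ =>
    have s₁ := v₁.supp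
    have s₂ := v₂.supp
    have d : ∀ i, i ∈ _ → i ∉ _ := fun i hi => Finset.disjoint_left.1 hd hi
    simp only [GroundRel.parallel]
    constructor
    · grind
    · grind

/-- The set `𝒱_o` of VSPs with ground set `o`. -/
def VSP {α : Type*} [DecidableEq α] (o : Finset α) : Type _ :=
  {h : GroundRel α // IsVSP h ∧ h.ground = o}

instance {α : Type*} [DecidableEq α] (o : Finset α) : Finite (VSP o) := by
  refine Finite.of_injective (β := o → o → Prop) (fun v i j => v.1.above i j) ?_
  rintro ⟨v, hv, rfl⟩ ⟨w, hw, hwo⟩ h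
  apply Subtype.ext
  refine GroundRel.ext hwo.symm ?_
  funext i j
  by_cases hij : i ∈ v.ground ∧ j ∈ v.ground
  · exact congrFun (congrFun h ⟨i, hij.1⟩) ⟨j, hij.2⟩
  · have h₁ : ¬ v.above i j := fun h' => hij (hv.supp i j h')
    have h₂ : ¬ w.above i j := fun h' => hij (hwo ▸ hw.supp i j h')
    exact propext ⟨fun h' => (h₁ h').elim, fun h' => (h₂ h').elim⟩

noncomputable instance {α : Type*} [DecidableEq α] (o : Finset α) : Fintype (VSP o) :=
  Fintype.ofFinite _

/-! ### Rooted binary trees with labelled leaves and typed internal nodes -/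

/-- Binary trees drawn in the plane, with leaves labelled in `α` and internal nodes carrying a type
in `L`. -/
inductive PlaneTree (L α : Type*)
  | leaf (a : α) : PlaneTree L α
  | node (x : L) (l r : PlaneTree L α) : PlaneTree L α

namespace PlaneTree

variable {L α : Type*}

/-- Two plane trees are identified if one is obtained from the other by exchanging the two children
of any number of nodes whose type is not `ordered`. -/
inductive Iso (ordered : L → Prop) : PlaneTree L α → PlaneTree L α → Prop
  | leaf (a : α) : Iso ordered (leaf a) (leaf a)
  | node (x : L) {l l' r r' : PlaneTree L α} (hl : Iso ordered l l') (hr : Iso ordered r r') :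
      Iso ordered (node x l r) (node x l' r')
  | swap (x : L) (hx : ¬ ordered x) {l l' r r' : PlaneTree L α}
      (hl : Iso ordered l l') (hr : Iso ordered r r') :
      Iso ordered (node x l r) (node x r' l')

theorem Iso.rfl {ordered : L → Prop} : ∀ t : PlaneTree L α, Iso ordered t t
  | .leaf a => .leaf a
  | .node x l r => .node x (Iso.rfl l) (Iso.rfl r)

theorem Iso.symm {ordered : L → Prop} {s t : PlaneTree L α} (h : Iso ordered s t) :
    Iso ordered t s := by
  induction h with
  | leaf a => exact .leaf a
  | node x _ _ hl hr => exact .node x hl hr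
  | swap x hx _ _ hl hr => exact .swap x hx hr hl

theorem Iso.trans {ordered : L → Prop} {s t u : PlaneTree L α} (h : Iso ordered s t)
    (h' : Iso ordered t u) : Iso ordered s u := by
  induction h generalizing u with
  | leaf a => exact h'
  | node x _ _ ihl ihr =>
    cases h' with
    | node _ kl kr => exact .node x (ihl kl) (ihr kr)
    | swap _ hx kl kr => exact .swap x hx (ihl kl) (ihr kr)
  | swap x hx _ _ ihl ihr =>
    cases h' with
    | node _ kl kr => exact .swap x hx (ihl kr) (ihr kl)
    | swap _ _ kl kr => exact .node x (ihl kr) (ihr kl)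

/-- The setoid of `Iso`. -/
def setoid (ordered : L → Prop) (α : Type*) : Setoid (PlaneTree L α) :=
  ⟨Iso ordered, Iso.rfl, Iso.symm, Iso.trans⟩

/-- The leaf labels, with multiplicity. -/
def leaves : PlaneTree L α → Multiset α
  | leaf a => {a}
  | node _ l r => l.leaves + r.leaves

/-- Forget the types of the internal nodes. -/
def shape : PlaneTree L α → PlaneTree Unit α
  | leaf a => leaf a
  | node _ l r => node () l.shape r.shape

/-- The internal nodes of type `x`.  A node is identified with the set of actors at the leaves below
it: for trees with distinct leaf labels, different nodes have different sets. -/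
def nodes [DecidableEq L] [DecidableEq α] (x : L) : PlaneTree L α → Finset (Finset α)
  | leaf _ => ∅
  | node y l r =>
      (if y = x then {(l.leaves + r.leaves).toFinset} else ∅) ∪ (l.nodes x ∪ r.nodes x)

/-- The edges, directed from parent to child, with nodes identified as in `nodes` (and the leaf of
the actor `a` with `{a}`). -/
def edges [DecidableEq α] : PlaneTree L α → Finset (Finset α × Finset α)
  | leaf _ => ∅
  | node _ l r =>
      {((l.leaves + r.leaves).toFinset, l.leaves.toFinset),
        ((l.leaves + r.leaves).toFinset, r.leaves.toFinset)} ∪ (l.edges ∪ r.edges)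

theorem Iso.leaves_eq {ordered : L → Prop} {s t : PlaneTree L α} (h : Iso ordered s t) :
    s.leaves = t.leaves := by
  induction h with
  | leaf a => rfl
  | node x _ _ hl hr => simp [leaves, hl, hr]
  | swap x hx _ _ hl hr => simp [leaves, hl, hr, add_comm]

theorem Iso.shape_iso {ordered : L → Prop} {s t : PlaneTree L α} (h : Iso ordered s t) :
    Iso (fun _ => False) s.shape t.shape := by
  induction h with
  | leaf a => exact .leaf a
  | node x _ _ hl hr => exact .node () hl hr
  | swap x hx _ _ hl hr => exact .swap () id hl hr

theorem shape_leaves (t : PlaneTree L α) : t.shape.leaves = t.leaves := by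
  induction t with
  | leaf a => rfl
  | node x l r hl hr => simp [shape, leaves, hl, hr]

theorem Iso.nodes_eq [DecidableEq L] [DecidableEq α] {ordered : L → Prop} {s t : PlaneTree L α}
    (h : Iso ordered s t) (x : L) : s.nodes x = t.nodes x := by
  induction h with
  | leaf a => rfl
  | node y hl' hr' hl hr => simp only [nodes, hl, hr, hl'.leaves_eq, hr'.leaves_eq]
  | swap y hx hl' hr' hl hr =>
    rw [nodes, nodes, hl, hr, hl'.leaves_eq, hr'.leaves_eq, add_comm, Finset.union_comm (nodes x _)]

theorem Iso.edges_eq [DecidableEq α] {ordered : L → Prop} {s t : PlaneTree L α}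
    (h : Iso ordered s t) : s.edges = t.edges := by
  induction h with
  | leaf a => rfl
  | node y hl' hr' hl hr => simp only [edges, hl, hr, hl'.leaves_eq, hr'.leaves_eq]
  | swap y hx hl' hr' hl hr =>
    rw [edges, edges, hl, hr, hl'.leaves_eq, hr'.leaves_eq, add_comm, Finset.union_comm (edges _),
      Finset.pair_comm]

theorem leaves_card_pos (t : PlaneTree L α) : 0 < t.leaves.card := by
  induction t with
  | leaf a => simp [leaves]
  | node x l r hl hr => simp only [leaves, Multiset.card_add]; omega

theorem finite_of_leaves [Finite L] (o : Finset α) (n : ℕ) :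
    {t : PlaneTree L α | t.leaves.card ≤ n ∧ ∀ a ∈ t.leaves, a ∈ o}.Finite := by
  induction n with
  | zero =>
    refine Set.finite_empty.subset ?_
    rintro t ⟨h, -⟩
    have := t.leaves_card_pos
    omega
  | succ n ih =>
    have hx : (⋃ x : L, Set.image2 (node x)
        {t : PlaneTree L α | t.leaves.card ≤ n ∧ ∀ a ∈ t.leaves, a ∈ o}
        {t : PlaneTree L α | t.leaves.card ≤ n ∧ ∀ a ∈ t.leaves, a ∈ o}).Finite :=
      Set.finite_iUnion fun x => ih.image2 _ ih
    refine ((o.finite_toSet.image leaf).union hx).subset ?_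
    rintro (a | ⟨x, l, r⟩) ⟨hc, hm⟩
    · exact Or.inl ⟨a, hm a (by simp [leaves]), rfl⟩
    · right
      have h₁ := l.leaves_card_pos
      have h₂ := r.leaves_card_pos
      simp only [leaves, Multiset.card_add, Multiset.mem_add] at hc hm
      exact Set.mem_iUnion.2 ⟨x, l, ⟨by omega, fun a ha => hm a (Or.inl ha)⟩, r,
        ⟨by omega, fun a ha => hm a (Or.inr ha)⟩, rfl⟩

end PlaneTree

/-- Binary trees up to exchanging the children of nodes of non-`ordered` type, whose leaves are
labelled bijectively by the actors in `o`. -/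
def TreeOn {L α : Type*} (ordered : L → Prop) (o : Finset α) : Type _ :=
  {t : Quotient (PlaneTree.setoid ordered α) //
    Quotient.lift PlaneTree.leaves (fun _ _ h => PlaneTree.Iso.leaves_eq h) t = o.val}

instance {L α : Type*} [Finite L] (ordered : L → Prop) (o : Finset α) :
    Finite (TreeOn ordered o) := by
  have hf := PlaneTree.finite_of_leaves (L := L) o o.card
  refine Set.Finite.to_subtype
    ((hf.image (Quotient.mk (PlaneTree.setoid ordered α))).subset ?_)
  intro t
  induction t using Quotient.inductionOn with
  | h t =>
    intro ht
    change t.leaves = o.val at ht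
    exact ⟨t, ⟨by rw [ht]; rfl, fun a ha => by rwa [ht] at ha⟩, rfl⟩

noncomputable instance {L α : Type*} [Finite L] (ordered : L → Prop) (o : Finset α) :
    Fintype (TreeOn ordered o) :=
  Fintype.ofFinite _

/-- Binary tree topologies with distinguishable leaves `o`: no node types, no order of children. -/
abbrev Topology {α : Type*} (o : Finset α) : Type _ :=
  TreeOn (fun _ : Unit => False) o

/-- The two types of internal nodes. -/
inductive NodeType
  | S
  | P
  deriving DecidableEq

instance : Fintype NodeType where
  elems := {NodeType.S, NodeType.P}
  complete x := by cases x <;> simp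

/-- Binary decomposition trees on the actors `o`: each internal node is of type `S` or `P`; the
children of an `S`-node are ordered (the first one is the upper child), those of a `P`-node are
not. -/
abbrev BDT {α : Type*} (o : Finset α) : Type _ :=
  TreeOn (fun x : NodeType => x = NodeType.S) o

/-- The order represented by a plane drawing of a BDT: `S`-nodes are merged in series, the first
(upper) child above the second one, and `P`-nodes in parallel. -/
def PlaneTree.toRel {α : Type*} [DecidableEq α] : PlaneTree NodeType α → GroundRel α
  | .leaf a => GroundRel.single a
  | .node NodeType.S l r => l.toRel.series r.toRel
  | .node NodeType.P l r => l.toRel.parallel r.toRel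

theorem PlaneTree.toRel_ground {α : Type*} [DecidableEq α] (t : PlaneTree NodeType α) :
    t.toRel.ground = t.leaves.toFinset := by
  induction t with
  | leaf a => simp [toRel, leaves, GroundRel.single]
  | node x l r hl hr =>
    cases x <;> simp [toRel, leaves, GroundRel.series, GroundRel.parallel, hl, hr]

theorem PlaneTree.toRel_isVSP {α : Type*} [DecidableEq α] (t : PlaneTree NodeType α)
    (ht : t.leaves.Nodup) : IsVSP t.toRel := by
  induction t with
  | leaf a => exact .single a
  | node x l r hl hr =>
    obtain ⟨h₁, h₂, h₃⟩ := Multiset.nodup_add.1 ht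
    have hd : Disjoint l.toRel.ground r.toRel.ground := by
      rw [toRel_ground, toRel_ground, Multiset.disjoint_toFinset]
      exact h₃
    cases x
    · exact .series hd (hl h₁) (hr h₂)
    · exact .parallel hd (hl h₁) (hr h₂)

theorem PlaneTree.Iso.toRel_eq {α : Type*} [DecidableEq α] {s t : PlaneTree NodeType α}
    (h : Iso (fun x => x = NodeType.S) s t) : s.toRel = t.toRel := by
  induction h with
  | leaf a => rfl
  | node x _ _ hl hr => cases x <;> simp [toRel, hl, hr]
  | swap x hx _ _ hl hr =>
    cases x
    · exact (hx _root_.rfl).elim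
    · simp only [toRel, GroundRel.parallel, hl, hr, GroundRel.mk.injEq]
      exact ⟨Finset.union_comm _ _, by funext i j; exact propext or_comm⟩

namespace BDT

variable {α : Type*} {o : Finset α}

/-- The underlying topology of a BDT. -/
def topology (t : BDT o) : Topology o :=
  ⟨Quotient.map' (s₁ := PlaneTree.setoid _ α) (s₂ := PlaneTree.setoid _ α) PlaneTree.shape
      (fun _ _ h => PlaneTree.Iso.shape_iso h) t.1, by
    obtain ⟨t, ht⟩ := t
    induction t using Quotient.inductionOn with
    | h t => exact (PlaneTree.shape_leaves t).trans ht⟩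

variable [DecidableEq α]

/-- The VSP `v(t)` represented by the BDT `t`. -/
def toVSP (t : BDT o) : VSP o :=
  ⟨Quotient.lift PlaneTree.toRel (fun _ _ h => PlaneTree.Iso.toRel_eq h) t.1, by
    obtain ⟨t, ht⟩ := t
    induction t using Quotient.inductionOn with
    | h t =>
      change t.leaves = o.val at ht
      refine ⟨t.toRel_isVSP (ht ▸ o.nodup), (t.toRel_ground).trans ?_⟩
      rw [ht, Finset.val_toFinset]⟩

/-- The internal nodes of type `x`. -/
def nodes (t : BDT o) (x : NodeType) : Finset (Finset α) :=
  Quotient.lift (PlaneTree.nodes x) (fun _ _ h => PlaneTree.Iso.nodes_eq h x) t.1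

/-- The set of edges, from parent to child. -/
def edges (t : BDT o) : Finset (Finset α × Finset α) :=
  Quotient.lift PlaneTree.edges (fun _ _ h => PlaneTree.Iso.edges_eq h) t.1

/-- The graph on the internal nodes of type `x` formed by the edges of the tree. -/
def typeGraph (t : BDT o) (x : NodeType) : SimpleGraph {c // c ∈ t.nodes x} :=
  SimpleGraph.fromRel fun c d => (c.1, d.1) ∈ t.edges

/-- The `x`-clusters of `t`: maximal sets of internal nodes of type `x` connected by edges. -/
abbrev Cluster (t : BDT o) (x : NodeType) : Type _ := (t.typeGraph x).ConnectedComponent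

noncomputable instance (t : BDT o) (x : NodeType) : Fintype (t.Cluster x) :=
  Fintype.ofFinite _

/-- The number of nodes in a cluster. -/
noncomputable def clusterSize {t : BDT o} {x : NodeType} (C : t.Cluster x) : ℕ := C.supp.ncard

end BDT

/-! ### The priors -/

/-- The prior on BDTs with leaves `o`: a uniform tree topology, independent node types (`S` with
probability `q`), and a fair choice of the upper child at each `S`-node. -/
noncomputable def treePrior {α : Type*} [DecidableEq α] (q : ℝ) {o : Finset α} (t : BDT o) : ℝ :=
  1 / (Fintype.card (Topology o) : ℝ) * (q / 2) ^ (t.nodes NodeType.S).card *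
    (1 - q) ^ (o.card - (t.nodes NodeType.S).card - 1)

open Classical in
/-- The prior on VSPs: the image of the prior on BDTs. -/
noncomputable def vspPrior {α : Type*} [DecidableEq α] (q : ℝ) (o : Finset α) (v : VSP o) : ℝ :=
  ∑ t : BDT o with t.toVSP = v, treePrior q t

open Classical in
/-- Marginal consistency of a family of distributions on the sets `𝒱_o`. -/
def MarginallyConsistent {α : Type*} [DecidableEq α] (π : ∀ o : Finset α, VSP o → ℝ) : Prop :=
  ∀ o o' : Finset α, o.Nonempty → o ⊆ o' →
    ∀ w : VSP o, π o w = ∑ v : VSP o' with v.1.restrict o = w.1, π o' v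

open Classical in
/-- The marginal on topologies of the prior on BDTs. -/
noncomputable def topologyMarginal {α : Type*} [DecidableEq α] (q : ℝ) {o : Finset α}
    (τ : Topology o) : ℝ :=
  ∑ t : BDT o with t.topology = τ, treePrior q t

/-- The `s`-th Catalan number, `(2s choose s) / (s + 1)`. -/
noncomputable def catalanNumber (s : ℕ) : ℝ := 1 / ((s : ℝ) + 1) * ((2 * s).choose s : ℝ)

end VSPPrior

/-! Trees with unordered children are traded for plane trees. Leaf labels are distinct, so a tree
with `k` unordered nodes has exactly `2 ^ k` drawings, and a sum over trees is a sum over plane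
trees with a factor `1/2` per unordered node (`sum_treeOn`). Under the prior a plane tree then
carries weight `q / 2` per `S`-node and `(1 - q) / 2` per `P`-node, up to the constant `1 /
(2n-3)!!` (`sum_treePrior`). The two weights add up to `1/2`, whatever `q` is.

Projectivity rests on leaf insertion. Every plane tree on `A ∪ {z}` arises exactly once from a plane
tree on `A` by grafting `z` onto one of its `2n - 1` edges (the root edge included), on the left or
right of a new node of some type (`sum_planeTrees_insert`). For a statistic that does not see `z`,
the weighted sum is therefore multiplied by `(2n - 1) * 2 * ∑ w = 2n - 1`, which is the ratio of
consecutive double factorials. The order restricted to a set avoiding `z` is such a statistic: the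
leaf `z` becomes the empty order, neutral for both compositions. A constant statistic gives the
total mass and the number of topologies.

For the closed form, the mass of `v` is the total weight `repSum` of the plane trees representing
`v`. No order on two or more actors splits both in series and in parallel, so `v` forces the type
`x` of the root. Cutting a tree below its root cluster leaves parts whose leaf sets are pairwise
`x`-separated and not `x`-separable themselves. Hence no `x`-split of `v` cuts such a block, and the
mass factors into the weight of all arrangements of the blocks times the masses of the blocks
(`repSum_blocks`). In series the blocks form a chain and a split is a cut of the chain, which is the
Catalan recursion; in parallel every split is allowed and the arrangements are all binary trees with
the blocks as leaves, which gives the double factorial. Iterating over clusters (`repSum_leaves`)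
gives the product. The recursive clusters are finally identified with the connected components of
the type graphs (`BDT.prod_cluster`). -/

namespace VSPPrior

namespace PlaneTree

/-! ### Weighted sums over plane trees and leaf insertion. -/

section Sums

variable {L α : Type*}

open Classical in
/-- The plane trees with leaves labelled bijectively by `o`. -/
noncomputable def planeTrees (L : Type*) [Finite L] (o : Finset α) : Finset (PlaneTree L α) :=
  Set.Finite.toFinset (s := {t : PlaneTree L α | t.leaves = o.val}) <|
    (finite_of_leaves o o.card).subset fun t ht => by
      rw [Set.mem_ofPred_eq] at ht
      exact ⟨by rw [ht]; rfl, fun a ha => by rwa [ht] at ha⟩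

@[simp]
theorem mem_planeTrees [Finite L] {o : Finset α} {t : PlaneTree L α} :
    t ∈ planeTrees L o ↔ t.leaves = o.val := by
  simp [planeTrees]

theorem planeTrees_empty [Finite L] : planeTrees L (∅ : Finset α) = ∅ := by
  ext t
  have := t.leaves_card_pos
  simp only [mem_planeTrees, Finset.empty_val, Finset.notMem_empty, iff_false]
  intro h
  simp [h] at this

theorem leaves_node_card (x : L) (l r : PlaneTree L α) : 2 ≤ (node x l r).leaves.card := by
  have := l.leaves_card_pos
  have := r.leaves_card_pos
  simp only [leaves, Multiset.card_add]
  omega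

theorem planeTrees_singleton [Finite L] (a : α) :
    planeTrees L ({a} : Finset α) = {leaf a} := by
  ext t
  simp only [mem_planeTrees, Finset.singleton_val, Finset.mem_singleton]
  cases t with
  | leaf b => simp [leaves]
  | node x l r =>
    have := leaves_node_card x l r
    simp only [reduceCtorEq, iff_false]
    intro h
    simp [h] at this

/-- A tree with at least two leaves is a root type, the leaf set `B` of its left subtree, and two
subtrees. The improper choices `B = ∅` and `B = A` are harmless, since no tree has an empty leaf
set. -/
theorem sum_planeTrees [Fintype L] [DecidableEq α] {A : Finset α} (hA : 2 ≤ A.card)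
    (H : PlaneTree L α → ℝ) :
    ∑ t ∈ planeTrees L A, H t =
      ∑ x, ∑ B ∈ A.powerset, ∑ l ∈ planeTrees L B, ∑ r ∈ planeTrees L (A \ B), H (node x l r) := by
  have h₁ : ∀ (x : L) (B : Finset α),
      (∑ l ∈ planeTrees L B, ∑ r ∈ planeTrees L (A \ B), H (node x l r)) =
        ∑ p ∈ planeTrees L B ×ˢ planeTrees L (A \ B), H (node x p.1 p.2) :=
    fun x B => by rw [Finset.sum_product]
  simp only [h₁]
  simp only [Finset.sum_sigma']
  symm
  refine Finset.sum_bij (fun p _ => node p.1 p.2.2.1 p.2.2.2) ?_ ?_ ?_ ?_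
  · rintro ⟨x, B, l, r⟩ h
    simp only [Finset.mem_sigma, Finset.mem_univ, Finset.mem_powerset, true_and, Finset.mem_product,
      mem_planeTrees] at h
    obtain ⟨h₂, h₃, h₄⟩ := h
    simp only [mem_planeTrees, leaves, h₃, h₄, Finset.sdiff_val]
    exact add_tsub_cancel_of_le (Finset.val_le_iff.2 h₂)
  · rintro ⟨x, B, l, r⟩ h ⟨x', B', l', r'⟩ h' he
    simp only [Finset.mem_sigma, Finset.mem_univ, Finset.mem_powerset, true_and, Finset.mem_product,
      mem_planeTrees] at h h'
    simp only [node.injEq] at he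
    obtain ⟨rfl, rfl, rfl⟩ := he
    have : B = B' := Finset.val_injective (h.2.1.symm.trans h'.2.1)
    subst this
    rfl
  · intro t ht
    rw [mem_planeTrees] at ht
    cases t with
    | leaf a =>
      rw [← Finset.card_val, ← ht] at hA
      simp [leaves] at hA
    | node x l r =>
      simp only [leaves] at ht
      have hn : (l.leaves + r.leaves).Nodup := ht ▸ A.nodup
      obtain ⟨hl, hr, -⟩ := Multiset.nodup_add.1 hn
      refine ⟨⟨x, ⟨l.leaves, hl⟩, l, r⟩, ?_, rfl⟩
      simp only [Finset.mem_sigma, Finset.mem_univ, Finset.mem_powerset, true_and,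
        Finset.mem_product, mem_planeTrees, Finset.sdiff_val, ← ht]
      refine ⟨?_, (add_tsub_cancel_left _ _).symm⟩
      rw [← Finset.val_le_iff, ← ht]
      exact Multiset.le_add_right _ _
  · intros; rfl

/-- The product of the weights `w x` of the internal nodes. -/
def weight (w : L → ℝ) : PlaneTree L α → ℝ
  | leaf _ => 1
  | node x l r => w x * (l.weight w * r.weight w)

/-- The sum of `H` over all trees obtained by inserting a leaf `z` at the root edge or at another
edge of the tree, as left or right child of a new node. -/
def insertSum [Fintype L] (z : α) : PlaneTree L α → (PlaneTree L α → ℝ) → ℝ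
  | leaf a, H => ∑ x, (H (node x (leaf a) (leaf z)) + H (node x (leaf z) (leaf a)))
  | node y l r, H => ∑ x, (H (node x (node y l r) (leaf z)) + H (node x (leaf z) (node y l r))) +
      (insertSum z r (fun r' => H (node y l r')) + insertSum z l (fun l' => H (node y l' r)))

/-- The part of `insertSum` for insertions below the root. -/
def insertSumBelow [Fintype L] (z : α) : PlaneTree L α → (PlaneTree L α → ℝ) → ℝ
  | leaf _, _ => 0
  | node y l r, H =>
      insertSum z r (fun r' => H (node y l r')) + insertSum z l (fun l' => H (node y l' r))

theorem insertSum_eq [Fintype L] (z : α) (t : PlaneTree L α) (H : PlaneTree L α → ℝ) :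
    t.insertSum z H = ∑ x, (H (node x t (leaf z)) + H (node x (leaf z) t)) +
      t.insertSumBelow z H := by
  cases t <;> simp [insertSum, insertSumBelow]

/-- Split at the root: `z` lies in the right or in the left subtree. If it is alone there, it was
grafted onto the root edge; otherwise that subtree is a tree on a smaller set with `z` inserted, and
induction applies with the sibling held fixed inside `H`. -/
theorem sum_planeTrees_insert [Fintype L] [DecidableEq α] {z : α} {A : Finset α}
    (hA : A.Nonempty) (hz : z ∉ A) (H : PlaneTree L α → ℝ) :
    ∑ t ∈ planeTrees L (insert z A), H t = ∑ t ∈ planeTrees L A, t.insertSum z H := by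
  induction A using Finset.strongInduction generalizing H with
  | H A ih =>
  have hc : 2 ≤ (insert z A).card := by
    rw [Finset.card_insert_of_notMem hz]
    have := hA.card_pos
    omega
  have hright : ∀ x, ∀ B ∈ A.powerset, B ≠ A → ∀ l ∈ planeTrees L B,
      ∑ r ∈ planeTrees L (insert z A \ B), H (node x l r) =
        ∑ r ∈ planeTrees L (A \ B), r.insertSum z (fun r' => H (node x l r')) := by
    intro x B hB hBA l hl
    rw [Finset.mem_powerset] at hB
    rw [Finset.insert_sdiff_of_notMem _ (fun h => hz (hB h))]
    have hBn : B.Nonempty := by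
      by_contra hBe
      rw [Finset.not_nonempty_iff_eq_empty.1 hBe, planeTrees_empty] at hl
      simp at hl
    refine ih _ (Finset.sdiff_ssubset hB hBn) ?_ ?_ _
    · rw [Finset.sdiff_nonempty]
      exact fun h => hBA (hB.antisymm h)
    · simp [hz]
  have hleft : ∀ x, ∀ B ∈ A.powerset, B ≠ ∅ → ∀ r ∈ planeTrees L (A \ B),
      ∑ l ∈ planeTrees L (insert z B), H (node x l r) =
        ∑ l ∈ planeTrees L B, l.insertSum z (fun l' => H (node x l' r)) := by
    intro x B hB hBe r hr
    rw [Finset.mem_powerset] at hB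
    refine ih B ?_ (Finset.nonempty_iff_ne_empty.2 hBe) (fun h => hz (hB h)) _
    refine hB.ssubset_of_ne ?_
    rintro rfl
    rw [Finset.sdiff_self, planeTrees_empty] at hr
    simp at hr
  -- The term `B = A` on the left-hand side leaves `z` alone on the right and yields the root-edge
  -- grafts; on the right-hand side that term is zero because `A \ A` carries no tree.
  have hR : ∀ x, ∑ B ∈ A.powerset, ∑ l ∈ planeTrees L B,
        ∑ r ∈ planeTrees L (insert z A \ B), H (node x l r) =
      ∑ t ∈ planeTrees L A, H (node x t (leaf z)) + ∑ B ∈ A.powerset, ∑ l ∈ planeTrees L B,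
        ∑ r ∈ planeTrees L (A \ B), r.insertSum z (fun r' => H (node x l r')) := by
    intro x
    have hAm : A ∈ A.powerset := Finset.mem_powerset_self A
    rw [← Finset.add_sum_erase _ _ hAm, ← Finset.add_sum_erase (a := A) _ _ hAm]
    simp only [Finset.sdiff_self, planeTrees_empty, Finset.sum_empty, Finset.sum_const_zero,
      zero_add]
    have : insert z A \ A = {z} := by
      rw [Finset.insert_sdiff_of_notMem _ hz, Finset.sdiff_self]; rfl
    rw [this, planeTrees_singleton]
    simp only [Finset.sum_singleton]
    congr 1
    refine Finset.sum_congr rfl fun B hB => Finset.sum_congr rfl fun l hl => ?_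
    exact hright x B (Finset.mem_of_mem_erase hB) (Finset.ne_of_mem_erase hB) l hl
  have hL : ∀ x, ∑ B ∈ A.powerset, ∑ l ∈ planeTrees L (insert z B),
        ∑ r ∈ planeTrees L (insert z A \ insert z B), H (node x l r) =
      ∑ t ∈ planeTrees L A, H (node x (leaf z) t) + ∑ B ∈ A.powerset, ∑ l ∈ planeTrees L B,
        ∑ r ∈ planeTrees L (A \ B), l.insertSum z (fun l' => H (node x l' r)) := by
    intro x
    have hAm : ∅ ∈ A.powerset := Finset.empty_mem_powerset A
    have hs : ∀ B, insert z A \ insert z B = A \ B := by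
      intro B
      rw [Finset.insert_sdiff_insert, Finset.sdiff_insert_of_notMem hz]
    simp only [hs]
    rw [← Finset.add_sum_erase _ _ hAm, ← Finset.add_sum_erase (a := ∅) _ _ hAm]
    simp only [Finset.sdiff_empty, planeTrees_empty, Finset.sum_empty, zero_add, insert_empty_eq,
      planeTrees_singleton, Finset.sum_singleton]
    congr 1
    refine Finset.sum_congr rfl fun B hB => ?_
    rw [Finset.sum_comm, Finset.sum_comm (s := planeTrees L B)]
    exact Finset.sum_congr rfl fun r hr =>
      hleft x B (Finset.mem_of_mem_erase hB) (Finset.ne_of_mem_erase hB) r hr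
  have hbelow : ∑ t ∈ planeTrees L A, t.insertSumBelow z H =
      ∑ x, ∑ B ∈ A.powerset, ∑ l ∈ planeTrees L B, ∑ r ∈ planeTrees L (A \ B),
        (r.insertSum z (fun r' => H (node x l r')) + l.insertSum z (fun l' => H (node x l' r))) := by
    rcases Nat.lt_or_ge A.card 2 with h2 | h2
    · obtain ⟨a, rfl⟩ := Finset.card_eq_one.1 (show A.card = 1 by have := hA.card_pos; omega)
      rw [planeTrees_singleton, Finset.sum_singleton, insertSumBelow]
      symm
      refine Finset.sum_eq_zero fun x _ => Finset.sum_eq_zero fun B hB => ?_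
      rw [Finset.mem_powerset, Finset.subset_singleton_iff] at hB
      rcases hB with rfl | rfl <;> simp [planeTrees_empty]
    · exact sum_planeTrees h2 _
  rw [sum_planeTrees hc]
  simp only [Finset.sum_powerset_insert hz, hR, hL, insertSum_eq z _ H, Finset.sum_add_distrib,
    hbelow]
  rw [Finset.sum_comm (s := planeTrees L A), Finset.sum_comm (s := planeTrees L A)]
  ring

/-- Inserting a leaf `z` that an evaluation `E` of trees does not see multiplies weighted sums by
the number of ways to insert. -/
theorem insertSum_weight [Fintype L] {β : Type*} (w : L → ℝ) (z : α) (E : PlaneTree L α → β)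
    (op : L → β → β → β) (hE : ∀ x l r, E (node x l r) = op x (E l) (E r))
    (hl : ∀ x b, op x (E (leaf z)) b = b) (hr : ∀ x b, op x b (E (leaf z)) = b)
    (t : PlaneTree L α) (Γ : β → ℝ) :
    t.insertSum z (fun t' => t'.weight w * Γ (E t')) =
      (2 * t.leaves.card - 1 : ℝ) * (2 * ∑ x, w x) * (t.weight w * Γ (E t)) := by
  induction t generalizing Γ with
  | leaf a =>
    simp only [insertSum, weight, hE, hl, hr, leaves, Multiset.card_singleton, mul_one,
      Finset.mul_sum, Finset.sum_mul]
    refine Finset.sum_congr rfl fun x _ => ?_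
    push_cast
    ring
  | node y l r ihl ihr =>
    -- The root weight and the unchanged sibling are absorbed into the test function. With the root
    -- edge, the numbers of places then add up to `1 + (2a - 1) + (2b - 1) = 2(a + b) - 1`.
    have h₁ := ihr (fun b => w y * l.weight w * Γ (op y (E l) b))
    have h₂ := ihl (fun b => w y * r.weight w * Γ (op y b (E r)))
    have e₁ : (fun r' => (node y l r').weight w * Γ (E (node y l r'))) =
        fun r' => r'.weight w * (w y * l.weight w * Γ (op y (E l) (E r'))) := by
      funext r'; rw [hE, weight]; ring
    have e₂ : (fun l' => (node y l' r).weight w * Γ (E (node y l' r))) =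
        fun l' => l'.weight w * (w y * r.weight w * Γ (op y (E l') (E r))) := by
      funext r'; rw [hE, weight]; ring
    rw [insertSum, e₁, e₂, h₁, h₂]
    have e₃ : ∑ x, ((node x (node y l r) (leaf z)).weight w * Γ (E (node x (node y l r) (leaf z))) +
        (node x (leaf z) (node y l r)).weight w * Γ (E (node x (leaf z) (node y l r)))) =
        (2 * ∑ x, w x) * ((node y l r).weight w * Γ (E (node y l r))) := by
      rw [Finset.mul_sum, Finset.sum_mul]
      refine Finset.sum_congr rfl fun x _ => ?_
      rw [hE x, hE x, hl, hr]
      simp only [weight]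
      ring
    rw [e₃, hE]
    simp only [weight, leaves, Multiset.card_add]
    push_cast
    ring

open Nat in
-- At `n = 1` the truncated `2 * 1 - 3` is `0`, and `0‼ = 1` plays the role of `(-1)!!`.
theorem doubleFactorial_step {n : ℕ} (hn : 1 ≤ n) :
    ((2 * (n + 1) - 3)‼ : ℝ) = (2 * n - 1) * ((2 * n - 3)‼ : ℝ) := by
  obtain ⟨m, rfl⟩ := Nat.exists_eq_add_of_le hn
  rcases m with _ | m
  · simp [Nat.doubleFactorial]; norm_num
  · have h₁ : 2 * (1 + (m + 1) + 1) - 3 = (2 * m + 1) + 2 := by omega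
    have h₂ : 2 * (1 + (m + 1)) - 3 = 2 * m + 1 := by omega
    rw [h₁, h₂, Nat.doubleFactorial_add_two]
    push_cast
    ring

/-- Common source of normalisation (`E` constant) and of projectivity (`E` the restricted order). -/
theorem sum_weight_insert [Fintype L] [DecidableEq α] {β : Type*} (w : L → ℝ) {z : α}
    (E : PlaneTree L α → β) (op : L → β → β → β)
    (hE : ∀ x l r, E (node x l r) = op x (E l) (E r))
    (hl : ∀ x b, op x (E (leaf z)) b = b) (hr : ∀ x b, op x b (E (leaf z)) = b)
    {A : Finset α} (hA : A.Nonempty) (hz : z ∉ A) (Γ : β → ℝ) :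
    ∑ t ∈ planeTrees L (insert z A), t.weight w * Γ (E t) =
      (2 * A.card - 1 : ℝ) * (2 * ∑ x, w x) * ∑ t ∈ planeTrees L A, t.weight w * Γ (E t) := by
  rw [sum_planeTrees_insert hA hz, Finset.mul_sum]
  refine Finset.sum_congr rfl fun t ht => ?_
  rw [insertSum_weight w z E op hE hl hr, mem_planeTrees.1 ht, Finset.card_val]

open Nat in
theorem sum_weight [Fintype L] (w : L → ℝ) {A : Finset α} (hA : A.Nonempty) :
    ∑ t ∈ planeTrees L A, t.weight w =
      (2 * ∑ x, w x) ^ (A.card - 1) * ((2 * A.card - 3)‼ : ℝ) := by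
  classical
  induction hA using Finset.Nonempty.cons_induction with
  | singleton a => simp [planeTrees_singleton, weight, Nat.doubleFactorial]
  | cons z A hz hA ih =>
    have h := sum_weight_insert w (z := z) (fun _ : PlaneTree L α => ()) (fun _ _ _ => ())
      (fun _ _ _ => rfl) (fun _ _ => rfl) (fun _ _ => rfl) hA hz (fun _ => 1)
    simp only [mul_one] at h
    rw [Finset.cons_eq_insert, h, ih, Finset.card_insert_of_notMem hz,
      doubleFactorial_step hA.card_pos]
    obtain ⟨m, hm⟩ := Nat.exists_eq_add_of_le' hA.card_pos
    rw [hm]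
    simp only [Nat.add_sub_cancel]
    ring

theorem weight_mul (w w' : L → ℝ) (t : PlaneTree L α) :
    t.weight w * t.weight w' = t.weight (fun x => w x * w' x) := by
  induction t with
  | leaf a => simp [weight]
  | node x l r hl hr => simp only [weight, ← hl, ← hr]; ring

theorem weight_const (c : ℝ) (t : PlaneTree L α) :
    t.weight (fun _ => c) = c ^ (t.leaves.card - 1) := by
  induction t with
  | leaf a => simp [weight, leaves]
  | node x l r hl hr =>
    have h₁ := l.leaves_card_pos
    have h₂ := r.leaves_card_pos
    rw [weight, hl, hr, leaves, Multiset.card_add, ← pow_add, ← pow_succ']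
    congr 1
    omega

/-! ### Plane drawings of trees with unordered nodes. -/

theorem Iso.weight_eq {ordered : L → Prop} {s t : PlaneTree L α} (h : Iso ordered s t)
    (w : L → ℝ) : s.weight w = t.weight w := by
  induction h with
  | leaf a => rfl
  | node x _ _ hl hr => simp [weight, hl, hr]
  | swap x hx _ _ hl hr => simp only [weight, hl, hr]; ring

open Classical in
/-- All plane drawings of the tree drawn by `t`. -/
noncomputable def drawings (ordered : L → Prop) : PlaneTree L α → Finset (PlaneTree L α)
  | leaf a => {leaf a}
  | node x l r => Finset.image₂ (node x) (drawings ordered l) (drawings ordered r) ∪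
      if ordered x then ∅ else Finset.image₂ (node x) (drawings ordered r) (drawings ordered l)

open Classical in
theorem mem_drawings {ordered : L → Prop} {s t : PlaneTree L α} :
    s ∈ drawings ordered t ↔ Iso ordered s t := by
  induction t generalizing s with
  | leaf a =>
    simp only [drawings, Finset.mem_singleton]
    constructor
    · rintro rfl; exact .leaf a
    · intro h; cases h; rfl
  | node x l r ihl ihr =>
    simp only [drawings, Finset.mem_union, Finset.mem_image₂]
    constructor
    · rintro (⟨l', hl, r', hr, rfl⟩ | h)
      · exact .node x (ihl.1 hl) (ihr.1 hr)
      · split_ifs at h with hx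
        · simp at h
        · obtain ⟨r', hr, l', hl, rfl⟩ := Finset.mem_image₂.1 h
          exact .swap x hx (ihr.1 hr) (ihl.1 hl)
    · intro h
      cases h with
      | node _ hl hr => exact Or.inl ⟨_, ihl.2 hl, _, ihr.2 hr, rfl⟩
      | swap _ hx hl hr =>
        right
        rw [if_neg hx]
        exact Finset.mem_image₂.2 ⟨_, ihr.2 hl, _, ihl.2 hr, rfl⟩

open Classical in
-- Swapping the children of an unordered node always gives a new drawing: the two subtrees have
-- disjoint nonempty leaf sets, so neither is a drawing of the other.
theorem card_drawings (ordered : L → Prop) (t : PlaneTree L α) (ht : t.leaves.Nodup) :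
    ((drawings ordered t).card : ℝ) = t.weight (fun x => if ordered x then 1 else 2) := by
  induction t with
  | leaf a => simp [drawings, weight]
  | node x l r ihl ihr =>
    obtain ⟨hl, hr, hd⟩ := Multiset.nodup_add.1 ht
    have hinj : Function.Injective2 (node x : PlaneTree L α → PlaneTree L α → PlaneTree L α) := by
      intro a b c d h
      simpa using h
    rw [drawings, weight, ← ihl hl, ← ihr hr]
    by_cases hx : ordered x
    · simp [hx, Finset.card_image₂ hinj]
    · rw [if_neg hx, if_neg hx, Finset.card_union_of_disjoint, Finset.card_image₂ hinj,
        Finset.card_image₂ hinj]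
      · push_cast; ring
      · rw [Finset.disjoint_left]
        intro s h₁ h₂
        obtain ⟨l', hl', r', hr', rfl⟩ := Finset.mem_image₂.1 h₁
        obtain ⟨r'', hr'', l'', hl'', h⟩ := Finset.mem_image₂.1 h₂
        obtain ⟨-, rfl, rfl⟩ := node.inj h
        have e : l.leaves = r.leaves :=
          (mem_drawings.1 hl').leaves_eq.symm.trans (mem_drawings.1 hr'').leaves_eq
        rw [e] at hd
        obtain ⟨a, ha⟩ := Multiset.card_pos_iff_exists_mem.1 r.leaves_card_pos
        exact Multiset.disjoint_left.1 hd ha ha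

open Classical in
/-- Sums over trees as weighted sums over plane trees. -/
theorem sum_treeOn [Finite L] (ordered : L → Prop) {o : Finset α} (f : TreeOn ordered o → ℝ)
    (f' : PlaneTree L α → ℝ)
    (h : ∀ s (hs : s.leaves = o.val), f ⟨Quotient.mk (setoid ordered α) s, hs⟩ = f' s) :
    ∑ t, f t = ∑ s ∈ planeTrees L o, s.weight (fun x => if ordered x then 1 else 1 / 2) * f' s := by
  -- The value at a tree is spread evenly over its drawings; the factors `1/2` offset their number.
  have key : ∀ t : TreeOn ordered o, f t =
      ∑ s ∈ planeTrees L o with Quotient.mk (setoid ordered α) s = t.1,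
        s.weight (fun x => if ordered x then 1 else 1 / 2) * f' s := by
    rintro ⟨t, ht⟩
    induction t using Quotient.inductionOn with
    | h t =>
    change t.leaves = o.val at ht
    have hf : (planeTrees L o).filter (fun s => Quotient.mk (setoid ordered α) s =
        Quotient.mk (setoid ordered α) t) = drawings ordered t := by
      ext s
      rw [Finset.mem_filter, mem_planeTrees, mem_drawings, Quotient.eq]
      exact ⟨fun h => h.2, fun h => ⟨h.leaves_eq.trans ht, h⟩⟩
    have hc : ∀ s ∈ drawings ordered t,
        s.weight (fun x => if ordered x then 1 else 1 / 2) * f' s =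
          t.weight (fun x => if ordered x then 1 else 1 / 2) * f' t := by
      intro s hs
      have hi := mem_drawings.1 hs
      rw [hi.weight_eq, ← h t ht, ← h s (hi.leaves_eq.trans ht)]
      congr 2
      exact Subtype.ext (Quotient.sound hi)
    rw [h t ht, hf, Finset.sum_congr rfl hc, Finset.sum_const, nsmul_eq_mul,
      card_drawings ordered t (ht ▸ o.nodup), ← mul_assoc, weight_mul]
    have h1 : (fun x => (if ordered x then (1 : ℝ) else 2) * if ordered x then 1 else 1 / 2) =
        fun _ => 1 := by
      funext x; split_ifs <;> norm_num
    rw [h1, weight_const]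
    simp
  rw [Finset.sum_congr rfl fun t _ => key t]
  simp only [Finset.sum_filter]
  rw [Finset.sum_comm]
  refine Finset.sum_congr rfl fun s hs => ?_
  refine (Finset.sum_eq_single (⟨Quotient.mk (setoid ordered α) s, mem_planeTrees.1 hs⟩ :
    TreeOn ordered o) (fun t _ hne => if_neg ?_) ?_).trans (if_pos rfl)
  · exact fun h => hne (Subtype.ext h.symm)
  · exact fun h => (h (Finset.mem_univ (α := TreeOn ordered o) _)).elim

end Sums

end PlaneTree

/-! ### Series and parallel splits of an order. -/

section Separation

variable {α : Type*}

/-- The actors in `B` and `C` are related by `v` as those of the two children of a node of type `x`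
are. -/
def Sep (v : α → α → Prop) : NodeType → Finset α → Finset α → Prop
  | .S, B, C => ∀ i ∈ B, ∀ j ∈ C, v i j
  | .P, B, C => ∀ i ∈ B, ∀ j ∈ C, ¬ v i j ∧ ¬ v j i

variable {v : α → α → Prop} {x y : NodeType} {A B C : Finset α}

theorem Sep.mono (h : Sep v x B C) {B' C' : Finset α} (hB : B' ⊆ B) (hC : C' ⊆ C) :
    Sep v x B' C' := by
  cases x
  · exact fun i hi j hj => h i (hB hi) j (hC hj)
  · exact fun i hi j hj => h i (hB hi) j (hC hj)

theorem Sep.related_iff (h : Sep v x B C) {i j : α} (hi : i ∈ B) (hj : j ∈ C) :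
    (v i j ∨ v j i) ↔ x = NodeType.S := by
  cases x
  · simp [h i hi j hj]
  · simp [h i hi j hj]

theorem Sep.related_iff' (h : Sep v x B C ∨ Sep v x C B) {i j : α} (hi : i ∈ B) (hj : j ∈ C) :
    (v i j ∨ v j i) ↔ x = NodeType.S := by
  rcases h with h | h
  · exact h.related_iff hi hj
  · rw [or_comm]
    exact h.related_iff hj hi

theorem sep_biUnion [DecidableEq α] {I J : Finset (Finset α)} :
    Sep v x (I.biUnion id) (J.biUnion id) ↔ ∀ k ∈ I, ∀ k' ∈ J, Sep v x k k' := by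
  constructor
  · intro h k hk k' hk'
    exact h.mono (Finset.subset_biUnion_of_mem id hk) (Finset.subset_biUnion_of_mem id hk')
  · intro h
    cases x
    · intro i hi j hj
      obtain ⟨k, hk, hik⟩ := Finset.mem_biUnion.1 hi
      obtain ⟨k', hk', hjk⟩ := Finset.mem_biUnion.1 hj
      exact h k hk k' hk' i hik j hjk
    · intro i hi j hj
      obtain ⟨k, hk, hik⟩ := Finset.mem_biUnion.1 hi
      obtain ⟨k', hk', hjk⟩ := Finset.mem_biUnion.1 hj
      exact h k hk k' hk' i hik j hjk

/-- A set separated in one way is not separated in the other. -/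
theorem Sep.type_eq [DecidableEq α] (h : Sep v x B C) {B' C' : Finset α} (h' : Sep v y B' C')
    (hB : B.Nonempty) (hC : C.Nonempty) (hB' : B'.Nonempty) (hC' : C'.Nonempty)
    (he : B ∪ C = B' ∪ C') : x = y := by
  have hS : x = NodeType.S ↔ y = NodeType.S := by
    -- A pair separated by both splits decides both types, by whether it is comparable.
    have hcross : ∀ b ∈ B, ∀ c ∈ C, (b ∈ B' ∧ c ∈ C') ∨ (b ∈ C' ∧ c ∈ B') →
        (x = NodeType.S ↔ y = NodeType.S) := by
      rintro b hb c hc (⟨h₁, h₂⟩ | ⟨h₁, h₂⟩)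
      · rw [← h.related_iff hb hc, h'.related_iff h₁ h₂]
      · rw [← h.related_iff hb hc, or_comm, h'.related_iff h₂ h₁]
    have hm : ∀ i, i ∈ B ∨ i ∈ C ↔ i ∈ B' ∨ i ∈ C' := fun i => by
      simpa using Finset.ext_iff.1 he i
    obtain ⟨b, hb⟩ := hB
    obtain ⟨c, hc⟩ := hC
    obtain ⟨b', hb'⟩ := hB'
    obtain ⟨c', hc'⟩ := hC'
    have h₁ := (hm b).1 (Or.inl hb)
    have h₂ := (hm c).1 (Or.inr hc)
    have h₃ := (hm b').2 (Or.inl hb')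
    have h₄ := (hm c').2 (Or.inr hc')
    -- If `b` and `c` lie on the same side of the second split, an element of its other side forms
    -- such a pair with one of them.
    grind
  cases x <;> cases y <;> simp_all

end Separation

/-! ### Upper sets of finite chains. -/

section Chains

variable {ι : Type*} [DecidableEq ι]

theorem exists_bottom (R : ι → ι → Prop) (K : Finset ι)
    (htrans : ∀ a ∈ K, ∀ b ∈ K, ∀ c ∈ K, R a b → R b c → R a c)
    (htotal : ∀ a ∈ K, ∀ b ∈ K, a ≠ b → R a b ∨ R b a) (hK : K.Nonempty) :
    ∃ b ∈ K, ∀ a ∈ K, a ≠ b → R a b := by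
  induction hK using Finset.Nonempty.cons_induction with
  | singleton a => exact ⟨a, by simp, by simp⟩
  | cons c K hc hK ih =>
    obtain ⟨b, hb, hbot⟩ := ih
      (fun a ha b hb c hc => htrans a (by simp [ha]) b (by simp [hb]) c (by simp [hc]))
      (fun a ha b hb => htotal a (by simp [ha]) b (by simp [hb]))
    by_cases hcb : R c b
    · refine ⟨b, by simp [hb], fun a ha hab => ?_⟩
      rcases Finset.mem_cons.1 ha with rfl | ha
      · exact hcb
      · exact hbot a ha hab
    · have hbc : R b c :=
        (htotal b (by simp [hb]) c (by simp) (by rintro rfl; exact hc hb)).resolve_right hcb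
      refine ⟨c, by simp, fun a ha hac => ?_⟩
      rcases Finset.mem_cons.1 ha with rfl | ha
      · exact (hac rfl).elim
      · by_cases hab : a = b
        · exact hab ▸ hbc
        · exact htrans a (by simp [ha]) b (by simp [hb]) c (by simp) (hbot a ha hab) hbc

open Classical in
/-- A finite chain has exactly one upper set of each size. -/
theorem sum_upper_sets (R : ι → ι → Prop) (K : Finset ι)
    (htrans : ∀ a ∈ K, ∀ b ∈ K, ∀ c ∈ K, R a b → R b c → R a c)
    (htotal : ∀ a ∈ K, ∀ b ∈ K, a ≠ b → R a b ∨ R b a)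
    (hasymm : ∀ a ∈ K, ∀ b ∈ K, R a b → ¬ R b a) (F : ℕ → ℝ) :
    ∑ I ∈ K.powerset with (∀ a ∈ I, ∀ b ∈ K \ I, R a b), F I.card =
      ∑ j ∈ Finset.range (K.card + 1), F j := by
  induction K using Finset.strongInduction with
  | H K ih =>
  rcases K.eq_empty_or_nonempty with rfl | hK
  · simp
  obtain ⟨b, hb, hbot⟩ := exists_bottom R K htrans htotal hK
  obtain ⟨K', hbK', rfl⟩ : ∃ K', b ∉ K' ∧ K = insert b K' :=
    ⟨K.erase b, by simp, (Finset.insert_erase hb).symm⟩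
  have ih' := ih K' (Finset.ssubset_insert hbK')
    (fun a ha b hb c hc => htrans a (by simp [ha]) b (by simp [hb]) c (by simp [hc]))
    (fun a ha b hb => htotal a (by simp [ha]) b (by simp [hb]))
    (fun a ha b hb => hasymm a (by simp [ha]) b (by simp [hb]))
  rw [Finset.card_insert_of_notMem hbK', Finset.sum_range_succ, ← ih', Finset.sum_filter,
    Finset.sum_filter, Finset.sum_powerset_insert hbK']
  -- Upper sets avoiding the bottom `b` are those of `K'`; one containing `b` is everything, since a
  -- missing element would have to lie below `b`.
  congr 1
  · refine Finset.sum_congr rfl fun I hI => ?_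
    rw [Finset.mem_powerset] at hI
    refine if_congr ?_ rfl rfl
    constructor
    · intro h a ha c hc
      rw [Finset.mem_sdiff] at hc
      exact h a ha c (by simp [hc.1, hc.2])
    · intro h a ha c hc
      rw [Finset.mem_sdiff, Finset.mem_insert] at hc
      rcases hc.1 with rfl | hc'
      · exact hbot a (by simp [hI ha]) (by rintro rfl; exact hc.2 ha)
      · exact h a ha c (by simp [hc', hc.2])
  · rw [Finset.sum_eq_single K']
    · rw [if_pos (by simp), Finset.card_insert_of_notMem hbK']
    · intro I hI hne
      rw [Finset.mem_powerset] at hI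
      rw [if_neg]
      intro h
      obtain ⟨c, hc, hcI⟩ := Finset.exists_of_ssubset (hI.ssubset_of_ne hne)
      have hcb : c ≠ b := by rintro rfl; exact hbK' hc
      have h₁ := h b (by simp) c (by simp [hc, hcI, hcb])
      exact hasymm b (by simp) c (by simp [hc]) h₁ (hbot c (by simp [hc]) hcb)
    · simp

end Chains

/-! ### Total weight of the trees representing an order, and its factorisation over blocks. -/

section Representation

variable {α : Type*} [DecidableEq α] {v : α → α → Prop} {x y : NodeType} {A B C : Finset α}

open PlaneTree

/-- The order drawn by `t` agrees with `v` on the leaves of `t`. -/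
def Represents (v : α → α → Prop) (t : PlaneTree NodeType α) : Prop :=
  ∀ i ∈ t.leaves, ∀ j ∈ t.leaves, (t.toRel.above i j ↔ v i j)

theorem PlaneTree.toRel_supp {t : PlaneTree NodeType α} (ht : t.leaves.Nodup) {i j : α}
    (h : t.toRel.above i j) : i ∈ t.leaves ∧ j ∈ t.leaves := by
  have := (t.toRel_isVSP ht).supp i j h
  simpa [t.toRel_ground] using this

/-- Makes representation a condition on each subtree plus one on the root split, so that weights
factor in `repSum_eq`. At an `S`-node asymmetry of `v` excludes relations from the lower child to
the upper one. -/
theorem represents_node (hv : IsStrictOrder α v) {l r : PlaneTree NodeType α}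
    (hn : (l.leaves + r.leaves).Nodup) :
    Represents v (node x l r) ↔
      Represents v l ∧ Represents v r ∧ Sep v x l.leaves.toFinset r.leaves.toFinset := by
  obtain ⟨hl, hr, hd⟩ := Multiset.nodup_add.1 hn
  have sl := fun i j => toRel_supp hl (i := i) (j := j)
  have sr := fun i j => toRel_supp hr (i := i) (j := j)
  have hd' : ∀ i, i ∈ l.leaves → i ∉ r.leaves := fun i h h' => Multiset.disjoint_left.1 hd h h'
  have has : ∀ i j, v i j → ¬ v j i := fun i j h h' => hv.irrefl i (hv.trans _ _ _ h h')
  have gl : ∀ i, i ∈ l.toRel.ground ↔ i ∈ l.leaves := fun i => by simp [toRel_ground]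
  have gr : ∀ i, i ∈ r.toRel.ground ↔ i ∈ r.leaves := fun i => by simp [toRel_ground]
  unfold Represents
  cases x
  · simp only [leaves, Multiset.mem_add, toRel, GroundRel.series, Sep, Multiset.mem_toFinset, gl, gr]
    refine ⟨fun h => ⟨?_, ?_, ?_⟩, ?_⟩
    · grind
    · grind
    · grind
    · rintro ⟨h₁, h₂, h₃⟩
      grind
  · simp only [leaves, Multiset.mem_add, toRel, GroundRel.parallel, Sep, Multiset.mem_toFinset]
    refine ⟨fun h => ⟨?_, ?_, ?_⟩, ?_⟩
    · grind
    · grind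
    · grind
    · rintro ⟨h₁, h₂, h₃⟩
      grind

open Classical in
/-- The total weight of the plane trees that represent `v` on `A`. -/
noncomputable def repSum (w : NodeType → ℝ) (v : α → α → Prop) (A : Finset α) : ℝ :=
  ∑ t ∈ planeTrees NodeType A, if Represents v t then t.weight w else 0

theorem repSum_empty (w : NodeType → ℝ) (v : α → α → Prop) : repSum w v ∅ = 0 := by
  rw [repSum, planeTrees_empty, Finset.sum_empty]

theorem repSum_singleton (w : NodeType → ℝ) (hv : IsStrictOrder α v) (a : α) :
    repSum w v {a} = 1 := by
  have : Represents v (leaf a) := by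
    intro i hi j hj
    simp only [leaves, Multiset.mem_singleton] at hi hj
    subst hi hj
    simp [toRel, GroundRel.single, hv.irrefl]
  rw [repSum, planeTrees_singleton, Finset.sum_singleton, if_pos this, weight]

open Classical in
theorem repSum_eq (w : NodeType → ℝ) (hv : IsStrictOrder α v) (hA : 2 ≤ A.card) :
    repSum w v A = ∑ x, w x * ∑ B ∈ A.powerset with Sep v x B (A \ B),
      repSum w v B * repSum w v (A \ B) := by
  rw [repSum, sum_planeTrees hA]
  refine Finset.sum_congr rfl fun x _ => ?_
  rw [Finset.sum_filter, Finset.mul_sum]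
  refine Finset.sum_congr rfl fun B hB => ?_
  rw [Finset.mem_powerset] at hB
  have hF : ∀ l ∈ planeTrees NodeType B, ∀ r ∈ planeTrees NodeType (A \ B),
      (if Represents v (node x l r) then (node x l r).weight w else 0) =
        (if Sep v x B (A \ B) then w x else 0) * ((if Represents v l then l.weight w else 0) *
          (if Represents v r then r.weight w else 0)) := by
    intro l hl r hr
    rw [mem_planeTrees] at hl hr
    have hn : (l.leaves + r.leaves).Nodup := by
      rw [hl, hr, Finset.sdiff_val, add_tsub_cancel_of_le (Finset.val_le_iff.2 hB)]
      exact A.nodup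
    have hrep := represents_node (x := x) hv hn
    rw [hl, hr, Finset.val_toFinset, Finset.val_toFinset] at hrep
    rw [weight, if_congr hrep rfl rfl]
    by_cases h₁ : Represents v l <;> by_cases h₂ : Represents v r <;>
      by_cases h₃ : Sep v x B (A \ B) <;> simp [h₁, h₂, h₃]
  rw [Finset.sum_congr rfl fun l hl => Finset.sum_congr rfl fun r hr => hF l hl r hr]
  simp only [← Finset.mul_sum]
  rw [← Finset.sum_mul, ← repSum, ← repSum]
  split_ifs <;> simp

/-- `K` consists of disjoint nonempty sets, any two of them separated as by a node of type `x`, and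
none of them separable in this way. -/
structure IsBlocks (v : α → α → Prop) (x : NodeType) (K : Finset (Finset α)) : Prop where
  nonempty : ∀ k ∈ K, k.Nonempty
  disjoint : ∀ k ∈ K, ∀ k' ∈ K, k ≠ k' → Disjoint k k'
  sep : ∀ k ∈ K, ∀ k' ∈ K, k ≠ k' → Sep v x k k' ∨ Sep v x k' k
  inseparable : ∀ k ∈ K, ∀ B C, Disjoint B C → B ∪ C = k → Sep v x B C → B = ∅ ∨ C = ∅

namespace IsBlocks

variable {K : Finset (Finset α)}

theorem subset (hK : IsBlocks v x K) {I : Finset (Finset α)} (hI : I ⊆ K) : IsBlocks v x I where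
  nonempty k hk := hK.nonempty k (hI hk)
  disjoint k hk k' hk' := hK.disjoint k (hI hk) k' (hI hk')
  sep k hk k' hk' := hK.sep k (hI hk) k' (hI hk')
  inseparable k hk := hK.inseparable k (hI hk)

theorem eq_of_mem (hK : IsBlocks v x K) {k k' : Finset α} (hk : k ∈ K) (hk' : k' ∈ K) {i : α}
    (hi : i ∈ k) (hi' : i ∈ k') : k = k' := by
  by_contra h
  exact Finset.disjoint_left.1 (hK.disjoint k hk k' hk' h) hi hi'

theorem biUnion_sdiff (hK : IsBlocks v x K) {I : Finset (Finset α)} (hI : I ⊆ K) :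
    K.biUnion id \ I.biUnion id = (K \ I).biUnion id := by
  ext i
  simp only [Finset.mem_sdiff, Finset.mem_biUnion, id]
  constructor
  · rintro ⟨⟨k, hk, hi⟩, h⟩
    exact ⟨k, ⟨hk, fun hkI => h ⟨k, hkI, hi⟩⟩, hi⟩
  · rintro ⟨k, ⟨hk, hkI⟩, hi⟩
    refine ⟨⟨k, hk, hi⟩, ?_⟩
    rintro ⟨k', hk', hi'⟩
    exact hkI (hK.eq_of_mem hk (hI hk') hi hi' ▸ hk')

/-- Some pair lies both in different blocks and on different sides of the split, and its
comparability decides both types. If the first choices `b`, `c` share a block, an element of another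
block pairs with one of them. -/
theorem type_eq (hK : IsBlocks v x K) (hc : 2 ≤ K.card) (h : Sep v y B C)
    (he : B ∪ C = K.biUnion id) (hB : B.Nonempty) (hC : C.Nonempty) : x = y := by
  have hS : ∀ i ∈ B, ∀ j ∈ C, ∀ k ∈ K, ∀ k' ∈ K, i ∈ k → j ∈ k' → k ≠ k' →
      (x = NodeType.S ↔ y = NodeType.S) := by
    intro i hi j hj k hk k' hk' hik hjk hkk
    rw [← Sep.related_iff' (hK.sep k hk k' hk' hkk) hik hjk, h.related_iff hi hj]
  have hm : ∀ i, i ∈ B ∨ i ∈ C ↔ ∃ k ∈ K, i ∈ k := fun i => by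
    simpa using Finset.ext_iff.1 he i
  suffices x = NodeType.S ↔ y = NodeType.S by cases x <;> cases y <;> simp_all
  obtain ⟨b, hb⟩ := hB
  obtain ⟨c, hc'⟩ := hC
  obtain ⟨k, hk, hbk⟩ := (hm b).1 (Or.inl hb)
  obtain ⟨k', hk', hck⟩ := (hm c).1 (Or.inr hc')
  by_cases hkk : k = k'
  · subst hkk
    obtain ⟨m, hmK, hne⟩ := Finset.exists_mem_ne (by omega : 1 < K.card) k
    obtain ⟨d, hd⟩ := hK.nonempty m hmK
    rcases (hm d).2 ⟨m, hmK, hd⟩ with hdB | hdC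
    · exact hS d hdB c hc' m hmK k hk hd hck hne
    · exact hS b hb d hdC k hk m hmK hbk hd hne.symm
  · exact hS b hb c hc' k hk k' hk' hbk hck hkk

open Classical in
-- A split of type `x` cannot cut a block `k`, as it would separate `k ∩ B` from `k \ B`. So the
-- splits of the union are the splits of the set of blocks.
theorem sum_splits (hK : IsBlocks v x K) (F : Finset α → Finset α → ℝ) :
    ∑ B ∈ (K.biUnion id).powerset with Sep v x B (K.biUnion id \ B), F B (K.biUnion id \ B) =
      ∑ I ∈ K.powerset with (∀ k ∈ I, ∀ k' ∈ K \ I, Sep v x k k'),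
        F (I.biUnion id) ((K \ I).biUnion id) := by
  symm
  refine Finset.sum_bij (fun I _ => I.biUnion id) ?_ ?_ ?_ ?_
  · intro I hI
    rw [Finset.mem_filter, Finset.mem_powerset] at hI ⊢
    refine ⟨Finset.biUnion_subset_biUnion_of_subset_left _ hI.1, ?_⟩
    rw [hK.biUnion_sdiff hI.1, sep_biUnion]
    exact hI.2
  · intro I hI J hJ he
    rw [Finset.mem_filter, Finset.mem_powerset] at hI hJ
    have key : ∀ I ⊆ K, ∀ J ⊆ K, I.biUnion id = J.biUnion id → I ⊆ J := by
      intro I hI J hJ he k hk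
      obtain ⟨i, hi⟩ := hK.nonempty k (hI hk)
      have : i ∈ J.biUnion id := he ▸ Finset.mem_biUnion.2 ⟨k, hk, hi⟩
      obtain ⟨k', hk', hi'⟩ := Finset.mem_biUnion.1 this
      exact hK.eq_of_mem (hI hk) (hJ hk') hi hi' ▸ hk'
    exact (key I hI.1 J hJ.1 he).antisymm (key J hJ.1 I hI.1 he.symm)
  · intro B hB
    rw [Finset.mem_filter, Finset.mem_powerset] at hB
    have hU : (K.filter (· ⊆ B)).biUnion id = B := by
      ext i
      simp only [Finset.mem_biUnion, Finset.mem_filter, id]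
      constructor
      · rintro ⟨k, ⟨-, hk⟩, hi⟩
        exact hk hi
      · intro hi
        obtain ⟨k, hk, hik⟩ := Finset.mem_biUnion.1 (hB.1 hi)
        refine ⟨k, ⟨hk, ?_⟩, hik⟩
        have hs : Sep v x (k ∩ B) (k \ B) := hB.2.mono Finset.inter_subset_right
          (Finset.sdiff_subset_sdiff (Finset.subset_biUnion_of_mem id hk) subset_rfl)
        rcases hK.inseparable k hk _ _ (Finset.disjoint_sdiff_inter k B).symm 
            (by rw [Finset.union_comm, Finset.sdiff_union_inter]) hs with h | h
        · have : i ∈ k ∩ B := Finset.mem_inter.2 ⟨hik, hi⟩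
          simp [h] at this
        · exact Finset.sdiff_eq_empty_iff_subset.1 h
    refine ⟨K.filter (· ⊆ B), ?_, hU⟩
    rw [Finset.mem_filter, Finset.mem_powerset]
    refine ⟨Finset.filter_subset _ _, ?_⟩
    rw [← sep_biUnion, ← hK.biUnion_sdiff (Finset.filter_subset _ _), hU]
    exact hB.2
  · intro I hI
    rw [Finset.mem_filter, Finset.mem_powerset] at hI
    rw [hK.biUnion_sdiff hI.1]

open Classical in
-- `g m` stands for the total weight of the ways to join `m` blocks by nodes of type `x`, and `hg`
-- is its recursion at the root. `repSum` obeys the same recursion, because the root type is forced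
-- and splits respect blocks. `g 0 = 0` matches `repSum_empty` and makes improper splits vanish.
theorem repSum_biUnion (hv : IsStrictOrder α v) (w : NodeType → ℝ) (g : ℕ → ℝ) (hg₀ : g 0 = 0)
    (hg₁ : g 1 = 1) (hK : IsBlocks v x K)
    (hg : ∀ K' ⊆ K, 2 ≤ K'.card → w x * ∑ I ∈ K'.powerset with
      (∀ k ∈ I, ∀ k' ∈ K' \ I, Sep v x k k'), g I.card * g (K' \ I).card = g K'.card) :
    repSum w v (K.biUnion id) = g K.card * ∏ k ∈ K, repSum w v k := by
  induction K using Finset.strongInduction with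
  | H K ih =>
  rcases Nat.lt_or_ge K.card 2 with hc | hc
  · obtain hc | hc : K.card = 0 ∨ K.card = 1 := by omega
    · rw [Finset.card_eq_zero] at hc
      simp [hc, repSum_empty, hg₀]
    · obtain ⟨k, rfl⟩ := Finset.card_eq_one.1 hc
      simp [hg₁]
  have hA : 2 ≤ (K.biUnion id).card := by
    rw [Finset.card_biUnion (t := id) fun k hk k' hk' h => hK.disjoint k hk k' hk' h]
    calc 2 ≤ ∑ k ∈ K, 1 := by simpa using hc
      _ ≤ _ := Finset.sum_le_sum fun k hk => (hK.nonempty k hk).card_pos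
  rw [repSum_eq w hv hA, Finset.sum_eq_single x]
  · rw [hK.sum_splits (fun B C => repSum w v B * repSum w v C), ← hg K subset_rfl hc, mul_assoc,
      Finset.sum_mul]
    congr 1
    refine Finset.sum_congr rfl fun I hI => ?_
    rw [Finset.mem_filter, Finset.mem_powerset] at hI
    have hsub : ∀ J ⊆ K, J ≠ K → repSum w v (J.biUnion id) = g J.card * ∏ k ∈ J, repSum w v k :=
      fun J hJ hne => ih J (hJ.ssubset_of_ne hne) (hK.subset hJ)
        fun K' hK' => hg K' (hK'.trans hJ)
    by_cases h₁ : I = K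
    · subst h₁
      simp [repSum_empty, hg₀]
    by_cases h₂ : K \ I = K
    · have : I = ∅ := by
        rw [Finset.sdiff_eq_self_iff_disjoint] at h₂
        exact Finset.disjoint_self_iff_empty _ |>.1 (h₂.mono_left hI.1)
      subst this
      simp [repSum_empty, hg₀]
    rw [hsub I hI.1 h₁, hsub (K \ I) Finset.sdiff_subset h₂, ← Finset.prod_sdiff hI.1]
    ring
  · intro y _ hy
    rw [Finset.sum_eq_zero, mul_zero]
    intro B hB
    rw [Finset.mem_filter, Finset.mem_powerset] at hB
    rcases B.eq_empty_or_nonempty with rfl | hBn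
    · rw [repSum_empty, zero_mul]
    rcases (K.biUnion id \ B).eq_empty_or_nonempty with h | hCn
    · rw [h, repSum_empty, mul_zero]
    exact (hy (hK.type_eq hc hB.2 (Finset.union_sdiff_of_subset hB.1) hBn hCn).symm).elim
  · simp

end IsBlocks

/-- The number of ways to arrange a cluster of `s` internal nodes of type `x`, as a subtree with
given parts. -/
noncomputable def arrangements : NodeType → ℕ → ℝ
  | .S, s => catalan s
  | .P, s => ((2 * s - 1).doubleFactorial : ℝ)

/-- The total weight of the plane arrangements of a cluster of `s` internal nodes. -/
noncomputable def clusterWeight (w : NodeType → ℝ) : NodeType → ℕ → ℝ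
  | .S, s => w .S ^ s * arrangements .S s
  | .P, s => (2 * w .P) ^ s * arrangements .P s

/-- Lets absent clusters enter products as factors `1`; for `P` the truncated `2 * 0 - 1` is `0`,
and `0‼ = 1`. -/
theorem clusterWeight_zero (w : NodeType → ℝ) (x : NodeType) : clusterWeight w x 0 = 1 := by
  cases x <;> simp [clusterWeight, arrangements]

/-- Joining `m` blocks takes `m - 1` nodes, hence the shift in the index. It remains to check the
root recursion of the arrangement counts, separately for chains and for antichains of blocks. -/
theorem repSum_blocks (hv : IsStrictOrder α v) (w : NodeType → ℝ) {K : Finset (Finset α)}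
    (hK : IsBlocks v x K) (hne : K.Nonempty) :
    repSum w v (K.biUnion id) = clusterWeight w x (K.card - 1) * ∏ k ∈ K, repSum w v k := by
  classical
  have := hK.repSum_biUnion hv w (fun m => if m = 0 then 0 else clusterWeight w x (m - 1))
    (by simp) (by simp [clusterWeight_zero]) ?_
  · rwa [if_neg hne.card_pos.ne'] at this
  intro K' hK' hc
  replace hK := hK.subset hK'
  rw [if_neg (by omega)]
  cases x
  · have hcard : ∀ I ∈ K'.powerset.filter (fun I => ∀ k ∈ I, ∀ k' ∈ K' \ I, Sep v .S k k'),
        (if I.card = 0 then 0 else clusterWeight w .S (I.card - 1)) *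
          (if (K' \ I).card = 0 then 0 else clusterWeight w .S ((K' \ I).card - 1)) =
        (fun j => (if j = 0 then 0 else clusterWeight w .S (j - 1)) *
          (if K'.card - j = 0 then 0 else clusterWeight w .S (K'.card - j - 1))) I.card := by
      intro I hI
      rw [Finset.mem_filter, Finset.mem_powerset] at hI
      rw [Finset.card_sdiff_of_subset hI.1]
    -- Blocks in series form a chain under `Sep`, so there is one split for each size of the upper
    -- half.
    rw [Finset.sum_congr rfl hcard, sum_upper_sets (Sep v .S) K' ?_ hK.sep ?_
      (fun j => (if j = 0 then 0 else clusterWeight w .S (j - 1)) *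
          (if K'.card - j = 0 then 0 else clusterWeight w .S (K'.card - j - 1)))]
    · obtain ⟨n, hn⟩ := Nat.exists_eq_add_of_le' hc
      -- The two end terms are the improper splits and vanish; the others form the Catalan
      -- convolution.
      rw [hn, Finset.sum_range_succ, Finset.sum_range_succ']
      simp only [Nat.add_eq_zero_iff, one_ne_zero, and_false, if_false, Nat.add_sub_cancel,
        Nat.sub_self, if_true, mul_zero, add_zero, zero_mul]
      rw [show n + 2 - 1 = n + 1 by omega]
      simp only [clusterWeight, arrangements, catalan_succ]
      rw [Finset.sum_range, pow_succ', mul_assoc, Nat.cast_sum, Finset.mul_sum,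
        Finset.mul_sum, Finset.mul_sum]
      refine Finset.sum_congr rfl fun i _ => ?_
      have hi := i.2
      rw [if_neg (by omega), show n + 2 - (i + 1) - 1 = n - i by omega]
      have : w .S ^ n = w .S ^ (i : ℕ) * w .S ^ (n - i) := by rw [← pow_add]; congr 1; omega
      rw [this]
      push_cast
      ring
    · intro a _ b hb c _ hab hbc i hi j hj
      obtain ⟨m, hm⟩ := hK.nonempty b hb
      exact hv.trans _ _ _ (hab i hi m hm) (hbc m hm j hj)
    · intro a ha b hb hab hba
      obtain ⟨i, hi⟩ := hK.nonempty a ha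
      obtain ⟨j, hj⟩ := hK.nonempty b hb
      exact hv.irrefl i (hv.trans _ _ _ (hab i hi j hj) (hba j hj i hi))
  · have hall : ∀ I ∈ K'.powerset, ∀ k ∈ I, ∀ k' ∈ K' \ I, Sep v .P k k' := by
      intro I hI k hk k' hk'
      rw [Finset.mem_powerset] at hI
      rw [Finset.mem_sdiff] at hk'
      rcases hK.sep k (hI hk) k' hk'.1 (by rintro rfl; exact hk'.2 hk) with h | h
      · exact h
      · exact fun i hi j hj => (h j hj i hi).symm
    rw [Finset.filter_true_of_mem hall]
    -- Parallel arrangements are plane trees whose leaf labels are the blocks themselves, so the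
    -- recursion is `sum_planeTrees` for a single node type.
    have hW : ∀ J : Finset (Finset α), (if J.card = 0 then 0 else clusterWeight w .P (J.card - 1)) =
        ∑ t ∈ planeTrees Unit J, t.weight (fun _ => w .P) := by
      intro J
      split_ifs with h
      · rw [Finset.card_eq_zero.1 h, planeTrees_empty, Finset.sum_empty]
      · rw [sum_weight _ (Finset.card_pos.1 (Nat.pos_of_ne_zero h)), clusterWeight, arrangements,
          show 2 * (J.card - 1) - 1 = 2 * J.card - 3 by omega]
        simp
    have h := hW K'
    rw [if_neg (by omega)] at h
    rw [h, sum_planeTrees hc, Fintype.sum_unique, Finset.mul_sum]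
    refine Finset.sum_congr rfl fun I _ => ?_
    rw [hW, hW, Finset.sum_mul_sum, Finset.mul_sum]
    refine Finset.sum_congr rfl fun l _ => ?_
    rw [Finset.mul_sum]
    rfl

end Representation

namespace PlaneTree

/-! ### Cutting a tree below its root cluster. -/

section Clusters

variable {α : Type*}

/-- The number of nodes in the cluster of type `x` that contains the root (`0` if the root is not of
type `x`). -/
def rootSize (x : NodeType) : PlaneTree NodeType α → ℕ
  | leaf _ => 0
  | node y l r => if y = x then 1 + (l.rootSize x + r.rootSize x) else 0

/-- The product of `f` over the sizes of the clusters of type `x` that do not contain the root. -/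
def lowerProd (x : NodeType) (f : ℕ → ℝ) : PlaneTree NodeType α → ℝ
  | leaf _ => 1
  | node y l r => if y = x then l.lowerProd x f * r.lowerProd x f else
      (f (l.rootSize x) * l.lowerProd x f) * (f (r.rootSize x) * r.lowerProd x f)

/-- The product of `f` over the sizes of the clusters of type `x`, if `f 0 = 1`. -/
def clusterProd (x : NodeType) (f : ℕ → ℝ) (t : PlaneTree NodeType α) : ℝ :=
  f (t.rootSize x) * t.lowerProd x f

/-- The maximal subtrees whose root is not of type `x`. -/
def parts (x : NodeType) : PlaneTree NodeType α → List (PlaneTree NodeType α)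
  | leaf a => [leaf a]
  | node y l r => if y = x then l.parts x ++ r.parts x else [node y l r]

variable {x y : NodeType} {f : ℕ → ℝ}

theorem parts_length (x : NodeType) (t : PlaneTree NodeType α) :
    (t.parts x).length = t.rootSize x + 1 := by
  induction t with
  | leaf a => rfl
  | node y l r hl hr =>
    by_cases h : y = x
    · simp only [parts, h, if_true, List.length_append, hl, hr, rootSize]; omega
    · simp [parts, h, rootSize]

/-- No part has a root of type `x`, so the clusters of type `x` in the parts are those of `t` other
than the root cluster. -/
theorem prod_parts_same (hf : f 0 = 1) (x : NodeType) (t : PlaneTree NodeType α) :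
    ((t.parts x).map (clusterProd x f)).prod = t.lowerProd x f := by
  induction t with
  | leaf a => simp [parts, clusterProd, rootSize, lowerProd, hf]
  | node y l r hl hr =>
    by_cases h : y = x
    · simp only [parts, h, if_true, List.map_append, List.prod_append, hl, hr, lowerProd]
    · simp [parts, h, clusterProd, rootSize, hf]

/-- Every cut edge leaves a node of type `x`, so a cluster of another type lies inside one part. -/
theorem prod_parts_of_ne (hf : f 0 = 1) (hxy : x ≠ y) (t : PlaneTree NodeType α) :
    ((t.parts x).map (clusterProd y f)).prod = t.clusterProd y f := by
  induction t with
  | leaf a => simp [parts]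
  | node z l r hl hr =>
    by_cases h : z = x
    · simp only [parts, h, if_true, List.map_append, List.prod_append, hl, hr]
      simp [clusterProd, rootSize, lowerProd, hf, hxy]
    · simp [parts, h]

theorem rootSize_of_mem_parts {t p : PlaneTree NodeType α} (hp : p ∈ t.parts x) :
    p.rootSize x = 0 := by
  induction t with
  | leaf a =>
    simp only [parts, List.mem_singleton] at hp
    subst hp; rfl
  | node y l r hl hr =>
    by_cases h : y = x
    · simp only [parts, h, if_true, List.mem_append] at hp
      exact hp.elim hl hr
    · simp only [parts, h, if_false, List.mem_singleton] at hp
      subst hp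
      simp [rootSize, h]

theorem leaves_le_of_mem_parts {t p : PlaneTree NodeType α} (hp : p ∈ t.parts x) :
    p.leaves ≤ t.leaves := by
  induction t with
  | leaf a =>
    simp only [parts, List.mem_singleton] at hp
    rw [hp]
  | node y l r hl hr =>
    by_cases h : y = x
    · simp only [parts, h, if_true, List.mem_append] at hp
      rcases hp with hp | hp
      · exact (hl hp).trans (Multiset.le_add_right _ _)
      · exact (hr hp).trans (Multiset.le_add_left _ _)
    · simp only [parts, h, if_false, List.mem_singleton] at hp
      rw [hp]

theorem exists_mem_parts {t : PlaneTree NodeType α} {i : α} (hi : i ∈ t.leaves) :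
    ∃ p ∈ t.parts x, i ∈ p.leaves := by
  induction t with
  | leaf a => exact ⟨_, by simp [parts], hi⟩
  | node y l r hl hr =>
    by_cases h : y = x
    · rw [leaves, Multiset.mem_add] at hi
      simp only [parts, h, if_true, List.mem_append]
      rcases hi with hi | hi
      · obtain ⟨p, hp, hip⟩ := hl hi
        exact ⟨p, Or.inl hp, hip⟩
      · obtain ⟨p, hp, hip⟩ := hr hi
        exact ⟨p, Or.inr hp, hip⟩
    · exact ⟨_, by simp [parts, h], hi⟩

theorem leaves_toFinset_nonempty [DecidableEq α] (t : PlaneTree NodeType α) :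
    t.leaves.toFinset.Nonempty := by
  obtain ⟨a, ha⟩ := Multiset.card_pos_iff_exists_mem.1 t.leaves_card_pos
  exact ⟨a, Multiset.mem_toFinset.2 ha⟩

theorem clusterProd_pow_mul (x : NodeType) (c : ℝ) (f : ℕ → ℝ) (t : PlaneTree NodeType α) :
    t.clusterProd x (fun s => c ^ s * f s) =
      t.weight (fun y => if y = x then c else 1) * t.clusterProd x f := by
  -- The power of the still growing root cluster has to be carried along in the induction.
  suffices h : t.lowerProd x (fun s => c ^ s * f s) * c ^ t.rootSize x =
      t.weight (fun y => if y = x then c else 1) * t.lowerProd x f by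
    rw [clusterProd, clusterProd, mul_left_comm, ← h]
    ring
  induction t with
  | leaf a => simp [lowerProd, rootSize, weight]
  | node y l r hl hr =>
    by_cases h : y = x
    · simp only [lowerProd, rootSize, weight, h, if_true, pow_add, pow_one]
      linear_combination c * (l.lowerProd x (fun s => c ^ s * f s) * c ^ l.rootSize x) * hr +
        c * (r.weight (fun y => if y = x then c else 1) * r.lowerProd x f) * hl
    · simp only [lowerProd, rootSize, weight, h, if_false, pow_zero, mul_one, one_mul]
      linear_combination f (l.rootSize x) * f (r.rootSize x) *
        ((l.lowerProd x (fun s => c ^ s * f s) * c ^ l.rootSize x) * hr +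
        (r.weight (fun y => if y = x then c else 1) * r.lowerProd x f) * hl)

variable [DecidableEq α] {v : α → α → Prop}

/-- The leaf sets of the `parts`. -/
def blocks (x : NodeType) (t : PlaneTree NodeType α) : List (Finset α) :=
  (t.parts x).map fun p => p.leaves.toFinset

theorem represents_of_mem_parts (hv : IsStrictOrder α v) {t p : PlaneTree NodeType α}
    (hn : t.leaves.Nodup) (ht : Represents v t) (hp : p ∈ t.parts x) : Represents v p := by
  induction t with
  | leaf a =>
    simp only [parts, List.mem_singleton] at hp
    rwa [hp]
  | node y l r hl hr =>
    obtain ⟨h₁, h₂, -⟩ := (represents_node hv hn).1 ht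
    obtain ⟨hl', hr', -⟩ := Multiset.nodup_add.1 hn
    by_cases h : y = x
    · simp only [parts, h, if_true, List.mem_append] at hp
      exact hp.elim (hl hl' h₁) (hr hr' h₂)
    · simp only [parts, h, if_false, List.mem_singleton] at hp
      rwa [hp]

theorem blocks_pairwise (hv : IsStrictOrder α v) {t : PlaneTree NodeType α}
    (hn : t.leaves.Nodup) (ht : Represents v t) :
    (t.blocks x).Pairwise fun k k' => Disjoint k k' ∧ (Sep v x k k' ∨ Sep v x k' k) := by
  induction t with
  | leaf a => simp [blocks, parts]
  | node y l r hl hr =>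
    obtain ⟨h₁, h₂, h₃⟩ := (represents_node hv hn).1 ht
    obtain ⟨hl', hr', hd⟩ := Multiset.nodup_add.1 hn
    by_cases h : y = x
    · subst h
      rw [blocks, parts, if_pos rfl, List.map_append, List.pairwise_append]
      refine ⟨hl hl' h₁, hr hr' h₂, ?_⟩
      intro k hk k' hk'
      obtain ⟨p, hp, rfl⟩ := List.mem_map.1 hk
      obtain ⟨q, hq, rfl⟩ := List.mem_map.1 hk'
      have hpl := Multiset.toFinset_subset.2 (Multiset.subset_of_le (leaves_le_of_mem_parts hp))
      have hqr := Multiset.toFinset_subset.2 (Multiset.subset_of_le (leaves_le_of_mem_parts hq))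
      exact ⟨(Multiset.disjoint_toFinset.2 hd).mono hpl hqr, Or.inl (h₃.mono hpl hqr)⟩
    · simp [blocks, parts, h]

theorem blocks_nodup (hv : IsStrictOrder α v) {t : PlaneTree NodeType α}
    (hn : t.leaves.Nodup) (ht : Represents v t) : (t.blocks x).Nodup := by
  have h := blocks_pairwise (x := x) hv hn ht
  refine List.Pairwise.imp_of_mem ?_ h
  intro k k' hk _ hd he
  subst he
  obtain ⟨p, hp, rfl⟩ := List.mem_map.1 hk
  exact (leaves_toFinset_nonempty p).ne_empty (Finset.disjoint_self_iff_empty _ |>.1 hd.1)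

theorem biUnion_blocks (x : NodeType) (t : PlaneTree NodeType α) :
    (t.blocks x).toFinset.biUnion id = t.leaves.toFinset := by
  ext i
  simp only [Finset.mem_biUnion, List.mem_toFinset, blocks, List.mem_map, id, Multiset.mem_toFinset]
  constructor
  · rintro ⟨_, ⟨p, hp, rfl⟩, hi⟩
    exact Multiset.mem_of_le (leaves_le_of_mem_parts hp) (Multiset.mem_toFinset.1 hi)
  · intro hi
    obtain ⟨p, hp, hip⟩ := exists_mem_parts (x := x) hi
    exact ⟨_, ⟨p, hp, rfl⟩, Multiset.mem_toFinset.2 hip⟩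

/-- A part is a leaf or has a root of a type other than `x`; in the latter case its root split
excludes, by `Sep.type_eq`, any split of type `x`. -/
theorem isBlocks_blocks (hv : IsStrictOrder α v) {t : PlaneTree NodeType α}
    (hn : t.leaves.Nodup) (ht : Represents v t) : IsBlocks v x (t.blocks x).toFinset := by
  have hp := blocks_pairwise (x := x) hv hn ht
  have : Std.Symm fun k k' => Disjoint k k' ∧ (Sep v x k k' ∨ Sep v x k' k) :=
    ⟨fun a b h => ⟨h.1.symm, h.2.symm⟩⟩
  have hall := fun {a b} => hp.forall (a := a) (b := b)
  refine ⟨?_, ?_, ?_, ?_⟩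
  · intro k hk
    obtain ⟨p, hp, rfl⟩ := List.mem_map.1 (List.mem_toFinset.1 hk)
    exact leaves_toFinset_nonempty p
  · intro k hk k' hk' hne
    exact (hall (List.mem_toFinset.1 hk) (List.mem_toFinset.1 hk') hne).1
  · intro k hk k' hk' hne
    exact (hall (List.mem_toFinset.1 hk) (List.mem_toFinset.1 hk') hne).2
  · intro k hk B C hd he hs
    obtain ⟨p, hp, rfl⟩ := List.mem_map.1 (List.mem_toFinset.1 hk)
    by_contra! hne
    have hpr := represents_of_mem_parts hv hn ht hp
    have hpn := Multiset.nodup_of_le (leaves_le_of_mem_parts hp) hn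
    have hp0 := rootSize_of_mem_parts hp
    cases p with
    | leaf a =>
      obtain ⟨b, hb⟩ := hne.1
      obtain ⟨c, hc⟩ := hne.2
      have h₁ : b ∈ B ∪ C := Finset.mem_union_left _ hb
      have h₂ : c ∈ B ∪ C := Finset.mem_union_right _ hc
      rw [he] at h₁ h₂
      simp only [leaves, Multiset.toFinset_singleton, Finset.mem_singleton] at h₁ h₂
      subst h₁ h₂
      exact Finset.disjoint_left.1 hd hb hc
    | node y l r =>
      obtain ⟨-, -, h₃⟩ := (represents_node hv hpn).1 hpr
      have := hs.type_eq h₃ hne.1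
        hne.2 (leaves_toFinset_nonempty l)
        (leaves_toFinset_nonempty r) (by rw [he, leaves, Multiset.toFinset_add])
      simp [rootSize, this] at hp0

/-- Peels off the root cluster of type `x`: its `s` nodes join `s + 1` blocks and contribute
`clusterWeight w x s`, while the hypothesis supplies the weights of the blocks. -/
theorem repSum_leaves_step (hv : IsStrictOrder α v) (w : NodeType → ℝ) (hxy : x ≠ y)
    {t : PlaneTree NodeType α} (hn : t.leaves.Nodup) (ht : Represents v t)
    (ih : ∀ p ∈ t.parts x, repSum w v p.leaves.toFinset =
      p.clusterProd x (clusterWeight w x) * p.clusterProd y (clusterWeight w y)) :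
    repSum w v t.leaves.toFinset =
      t.clusterProd x (clusterWeight w x) * t.clusterProd y (clusterWeight w y) := by
  have hnd := blocks_nodup (x := x) hv hn ht
  have hlen : (t.blocks x).length = t.rootSize x + 1 := by rw [blocks, List.length_map, parts_length]
  rw [← biUnion_blocks x, repSum_blocks hv w (isBlocks_blocks hv hn ht), List.prod_toFinset _ hnd,
    List.toFinset_card_of_nodup hnd, hlen, blocks, List.map_map]
  · have : (t.parts x).map (repSum w v ∘ fun p => p.leaves.toFinset) = (t.parts x).map (fun p =>
        p.clusterProd x (clusterWeight w x) * p.clusterProd y (clusterWeight w y)) :=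
      List.map_congr_left ih
    rw [this, List.prod_map_mul, prod_parts_same (clusterWeight_zero w x),
      prod_parts_of_ne (clusterWeight_zero w y) hxy, ← mul_assoc]
    rfl
  · rw [← Finset.card_pos, List.toFinset_card_of_nodup hnd, hlen]
    omega

/-- The total weight of all plane trees that represent the same order as `t`. -/
theorem repSum_leaves (hv : IsStrictOrder α v) (w : NodeType → ℝ) (n : ℕ)
    (t : PlaneTree NodeType α) (hc : t.leaves.card ≤ n) (hn : t.leaves.Nodup)
    (ht : Represents v t) :
    repSum w v t.leaves.toFinset =
      t.clusterProd .S (clusterWeight w .S) * t.clusterProd .P (clusterWeight w .P) := by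
  induction n generalizing t with
  | zero =>
    have := t.leaves_card_pos
    omega
  | succ n ih =>
    cases t with
    | leaf a =>
      simp [leaves, repSum_singleton w hv, clusterProd, rootSize, lowerProd, clusterWeight_zero]
    | node x l r =>
      -- Taken with respect to the type of the root, the parts are proper subtrees; they need not be
      -- children, hence the induction on the number of leaves.
      have hsub : ∀ p ∈ (node x l r).parts x, p.leaves.card ≤ n := by
        intro p hp
        rw [parts, if_pos rfl, List.mem_append] at hp
        have h₁ := l.leaves_card_pos
        have h₂ := r.leaves_card_pos
        rw [leaves, Multiset.card_add] at hc
        rcases hp with hp | hp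
        · have := Multiset.card_le_card (leaves_le_of_mem_parts hp)
          omega
        · have := Multiset.card_le_card (leaves_le_of_mem_parts hp)
          omega
      have hparts : ∀ p ∈ (node x l r).parts x, repSum w v p.leaves.toFinset =
          p.clusterProd .S (clusterWeight w .S) * p.clusterProd .P (clusterWeight w .P) :=
        fun p hp => ih p (hsub p hp) (Multiset.nodup_of_le (leaves_le_of_mem_parts hp) hn)
          (represents_of_mem_parts hv hn ht hp)
      cases x
      · exact repSum_leaves_step hv w (by simp) hn ht hparts
      · rw [mul_comm]
        exact repSum_leaves_step hv w (by simp) hn ht fun p hp => by rw [hparts p hp, mul_comm]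

end Clusters

end PlaneTree

/-! ### Products over connected components. -/

section Components

/-- In a list of pairwise disjoint sets only `∅` can repeat, and its factor is `f 0 = 1`. -/
theorem prod_toFinset_of_pairwise_disjoint {β : Type*} [DecidableEq β] {f : ℕ → ℝ} (hf : f 0 = 1)
    (L : List (Finset β)) (hL : L.Pairwise Disjoint) :
    ∏ B ∈ L.toFinset, f B.card = (L.map fun B => f B.card).prod := by
  induction L with
  | nil => simp
  | cons B L ih =>
    rw [List.pairwise_cons] at hL
    rw [List.toFinset_cons, List.map_cons, List.prod_cons, ← ih hL.2]
    by_cases hB : B ∈ L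
    · have : B = ∅ := (Finset.disjoint_self_iff_empty _).1 (hL.1 B hB)
      rw [Finset.insert_eq_of_mem (List.mem_toFinset.2 hB), this]
      simp [hf]
    · rw [Finset.prod_insert (by simpa using hB)]

/-- A product over the connected components of a graph, if they are the nonempty members of a list
of disjoint sets. -/
theorem prod_components {β : Type*} [DecidableEq β] {N : Finset β}
    (G : SimpleGraph {c // c ∈ N}) [Fintype G.ConnectedComponent] {f : ℕ → ℝ} (hf : f 0 = 1)
    (L : List (Finset β)) (hL : L.Pairwise Disjoint) (hN : ∀ c, c ∈ N ↔ ∃ B ∈ L, c ∈ B)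
    (hadj : ∀ c d, G.Adj c d → ∃ B ∈ L, c.1 ∈ B ∧ d.1 ∈ B)
    (hconn : ∀ B ∈ L, ∀ c d, c.1 ∈ B → d.1 ∈ B → G.Reachable c d) :
    ∏ C : G.ConnectedComponent, f C.supp.ncard = (L.map fun B => f B.card).prod := by
  classical
  have huniq : ∀ B ∈ L, ∀ B' ∈ L, ∀ c, c ∈ B → c ∈ B' → B = B' := by
    intro B hB B' hB' c hc hc'
    by_contra hne
    exact Finset.disjoint_left.1 (hL.forall hB hB' hne) hc hc'
  have hreach : ∀ B ∈ L, ∀ c d, G.Reachable c d → c.1 ∈ B → d.1 ∈ B := by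
    rintro B hB c d ⟨p⟩ hc
    induction p with
    | nil => exact hc
    | cons h p ih =>
      obtain ⟨B', hB', h₁, h₂⟩ := hadj _ _ h
      exact ih (huniq B hB B' hB' _ hc h₁ ▸ h₂)
  -- The component of `c ∈ B` is exactly `B`: edges do not leave `B`, and `B` is connected.
  have hsupp : ∀ B ∈ L, ∀ c, c.1 ∈ B →
      (G.connectedComponentMk c).supp.toFinset.map (Function.Embedding.subtype _) = B := by
    intro B hB c hc
    ext d
    simp only [Finset.mem_map, Set.mem_toFinset, SimpleGraph.ConnectedComponent.mem_supp_iff,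
      SimpleGraph.ConnectedComponent.eq, Function.Embedding.subtype_apply]
    constructor
    · rintro ⟨d, hd, rfl⟩
      exact hreach B hB c d hd.symm hc
    · intro hd
      exact ⟨⟨d, (hN d).2 ⟨B, hB, hd⟩⟩, hconn B hB _ _ hd hc, rfl⟩
  rw [← prod_toFinset_of_pairwise_disjoint hf L hL,
    ← Finset.prod_filter_of_ne (p := Finset.Nonempty)]
  · refine Finset.prod_bij
      (fun C _ => C.supp.toFinset.map (Function.Embedding.subtype _)) ?_ ?_ ?_ ?_
    · intro C _
      induction C using SimpleGraph.ConnectedComponent.ind with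
      | h c =>
      obtain ⟨B, hB, hc⟩ := (hN c.1).1 c.2
      rw [hsupp B hB c hc, Finset.mem_filter, List.mem_toFinset]
      exact ⟨hB, ⟨_, hc⟩⟩
    · intro C _ C' _ h
      have h' := Finset.map_injective _ h
      exact SimpleGraph.ConnectedComponent.supp_injective (Set.toFinset_inj.1 h')
    · intro B hB
      rw [Finset.mem_filter, List.mem_toFinset] at hB
      obtain ⟨c, hc⟩ := hB.2
      exact ⟨G.connectedComponentMk ⟨c, (hN c).2 ⟨B, hB.1, hc⟩⟩, Finset.mem_univ _,
        hsupp B hB.1 _ hc⟩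
    · intro C _
      rw [Finset.card_map, Set.ncard_eq_toFinset_card']
  · intro B _ hB
    by_contra hne
    rw [Finset.not_nonempty_iff_eq_empty] at hne
    simp [hne, hf] at hB

end Components

namespace PlaneTree

/-! ### Recursive clusters as sets of nodes of the tree. -/

section ClusterBlocks

variable {α : Type*} [DecidableEq α] {x y : NodeType}

theorem subset_of_mem_nodes {t : PlaneTree NodeType α} {c : Finset α} (hc : c ∈ t.nodes x) :
    c ⊆ t.leaves.toFinset ∧ c.Nonempty := by
  induction t with
  | leaf a => simp [nodes] at hc
  | node y l r hl hr =>
    rw [nodes, Finset.mem_union, Finset.mem_union] at hc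
    rw [leaves, Multiset.toFinset_add]
    rcases hc with hc | hc | hc
    · split_ifs at hc
      · rw [Finset.mem_singleton.1 hc, Multiset.toFinset_add]
        exact ⟨subset_rfl, (leaves_toFinset_nonempty l).mono Finset.subset_union_left⟩
      · simp at hc
    · exact ⟨(hl hc).1.trans Finset.subset_union_left, (hl hc).2⟩
    · exact ⟨(hr hc).1.trans Finset.subset_union_right, (hr hc).2⟩

theorem disjoint_toFinset_leaves {l r : PlaneTree NodeType α} (hn : (node y l r).leaves.Nodup) :
    Disjoint l.leaves.toFinset r.leaves.toFinset :=
  Multiset.disjoint_toFinset.2 (Multiset.nodup_add.1 hn).2.2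

theorem disjoint_nodes {l r : PlaneTree NodeType α} (hn : (node y l r).leaves.Nodup) :
    Disjoint (l.nodes x) (r.nodes x) := by
  rw [Finset.disjoint_left]
  intro c h₁ h₂
  obtain ⟨i, hi⟩ := (subset_of_mem_nodes h₁).2
  exact Finset.disjoint_left.1 (disjoint_toFinset_leaves hn) ((subset_of_mem_nodes h₁).1 hi)
    ((subset_of_mem_nodes h₂).1 hi)

theorem notMem_nodes_left {l r : PlaneTree NodeType α} (hn : (node y l r).leaves.Nodup) :
    (l.leaves + r.leaves).toFinset ∉ l.nodes x := by
  intro h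
  obtain ⟨i, hi⟩ := leaves_toFinset_nonempty r
  exact Finset.disjoint_left.1 (disjoint_toFinset_leaves hn)
    ((subset_of_mem_nodes h).1 (by rw [Multiset.toFinset_add]; exact Finset.mem_union_right _ hi)) hi

theorem notMem_nodes_right {l r : PlaneTree NodeType α} (hn : (node y l r).leaves.Nodup) :
    (l.leaves + r.leaves).toFinset ∉ r.nodes x := by
  intro h
  obtain ⟨i, hi⟩ := leaves_toFinset_nonempty l
  exact Finset.disjoint_left.1 (disjoint_toFinset_leaves hn) hi
    ((subset_of_mem_nodes h).1 (by rw [Multiset.toFinset_add]; exact Finset.mem_union_left _ hi))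

/-- Distinct labels ensure that nodes named by their leaf sets are counted once: the sets from the
two subtrees are disjoint and nonempty, and the full leaf set occurs in neither subtree. -/
theorem weight_eq_pow_card_nodes (x : NodeType) (c : ℝ) {t : PlaneTree NodeType α}
    (hn : t.leaves.Nodup) :
    t.weight (fun y => if y = x then c else 1) = c ^ (t.nodes x).card := by
  induction t with
  | leaf a => simp [weight, nodes]
  | node y l r hl hr =>
    obtain ⟨hl', hr', -⟩ := Multiset.nodup_add.1 hn
    rw [weight, hl hl', hr hr', nodes]
    by_cases h : y = x
    · rw [if_pos h, if_pos h, Finset.card_union_of_disjoint, Finset.card_union_of_disjoint,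
        Finset.card_singleton, pow_add, pow_add, pow_one]
      · exact disjoint_nodes hn
      · rw [Finset.disjoint_singleton_left, Finset.mem_union, not_or]
        exact ⟨notMem_nodes_left hn, notMem_nodes_right hn⟩
    · rw [if_neg h, if_neg h, Finset.empty_union, Finset.card_union_of_disjoint
        (disjoint_nodes hn), pow_add, one_mul]

/-- Read off by comparing exponents when every node has weight `2`. -/
theorem card_nodes_add {t : PlaneTree NodeType α} (hn : t.leaves.Nodup) :
    (t.nodes .S).card + (t.nodes .P).card = t.leaves.card - 1 := by
  have h := weight_mul (fun y => if y = NodeType.S then (2 : ℝ) else 1)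
    (fun y => if y = NodeType.P then (2 : ℝ) else 1) t
  have h' : (fun y => (if y = NodeType.S then (2 : ℝ) else 1) *
      (if y = NodeType.P then (2 : ℝ) else 1)) = fun _ => 2 := by
    funext y; cases y <;> simp
  rw [h', weight_const, weight_eq_pow_card_nodes _ _ hn, weight_eq_pow_card_nodes _ _ hn,
    ← pow_add] at h
  exact_mod_cast pow_right_injective₀ (by norm_num) (by norm_num) h

/-- The nodes of the cluster of type `x` that contains the root. -/
def rootBlock (x : NodeType) : PlaneTree NodeType α → Finset (Finset α)
  | leaf _ => ∅
  | node y l r => if y = x then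
      insert (l.leaves + r.leaves).toFinset (l.rootBlock x ∪ r.rootBlock x) else ∅

/-- The clusters of type `x` that do not contain the root, and possibly empty sets. -/
def lowerBlocks (x : NodeType) : PlaneTree NodeType α → List (Finset (Finset α))
  | leaf _ => []
  | node y l r => if y = x then l.lowerBlocks x ++ r.lowerBlocks x else
      (l.rootBlock x :: l.lowerBlocks x) ++ (r.rootBlock x :: r.lowerBlocks x)

/-- The clusters of type `x`, and possibly empty sets. -/
def clusterBlocks (x : NodeType) (t : PlaneTree NodeType α) : List (Finset (Finset α)) :=
  t.rootBlock x :: t.lowerBlocks x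

theorem mem_nodes_iff {t : PlaneTree NodeType α} {c : Finset α} :
    c ∈ t.nodes x ↔ ∃ B ∈ t.clusterBlocks x, c ∈ B := by
  simp only [clusterBlocks, List.exists_mem_cons_iff]
  induction t with
  | leaf a => simp [nodes, rootBlock, lowerBlocks]
  | node y l r hl hr =>
    by_cases h : y = x
    · simp only [nodes, rootBlock, lowerBlocks, h, if_true, Finset.mem_union, Finset.mem_insert,
        Finset.mem_singleton, List.mem_append, hl, hr, or_and_right, exists_or]
      grind
    · simp only [nodes, rootBlock, lowerBlocks, h, if_false, Finset.mem_union, List.mem_append,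
        List.mem_cons, hl, hr, or_and_right, exists_or, exists_eq_left, Finset.notMem_empty,
        false_or]

theorem subset_nodes_of_mem_clusterBlocks {t : PlaneTree NodeType α} {B : Finset (Finset α)}
    (hB : B ∈ t.clusterBlocks x) : B ⊆ t.nodes x :=
  fun _ hc => mem_nodes_iff.2 ⟨B, hB, hc⟩

theorem rootBlock_subset_nodes {t : PlaneTree NodeType α} : t.rootBlock x ⊆ t.nodes x :=
  subset_nodes_of_mem_clusterBlocks (by simp [clusterBlocks])

theorem clusterBlocks_pairwise {t : PlaneTree NodeType α} (hn : t.leaves.Nodup) :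
    (t.clusterBlocks x).Pairwise Disjoint := by
  induction t with
  | leaf a => simp [clusterBlocks, lowerBlocks]
  | node y l r hl hr =>
    obtain ⟨hl', hr', -⟩ := Multiset.nodup_add.1 hn
    have h₁ := hl hl'
    have h₂ := hr hr'
    have hlr : ∀ B ∈ l.clusterBlocks x, ∀ B' ∈ r.clusterBlocks x, Disjoint B B' :=
      fun B hB B' hB' => (disjoint_nodes hn).mono (subset_nodes_of_mem_clusterBlocks hB)
        (subset_nodes_of_mem_clusterBlocks hB')
    rw [clusterBlocks, rootBlock, lowerBlocks]
    by_cases h : y = x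
    · rw [if_pos h, if_pos h, List.pairwise_cons, List.pairwise_append]
      rw [clusterBlocks, List.pairwise_cons] at h₁ h₂
      simp only [clusterBlocks, List.mem_cons] at hlr
      refine ⟨?_, h₁.2, h₂.2, fun B hB B' hB' => hlr B (Or.inr hB) B' (Or.inr hB')⟩
      intro B hB
      rw [Finset.disjoint_insert_left, Finset.disjoint_union_left]
      rcases List.mem_append.1 hB with hB | hB
      · exact ⟨fun h => notMem_nodes_left hn (x := x)
          (subset_nodes_of_mem_clusterBlocks (List.mem_cons_of_mem _ hB) h), h₁.1 B hB,
          (hlr B (Or.inr hB) _ (Or.inl rfl)).symm⟩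
      · exact ⟨fun h => notMem_nodes_right hn (x := x)
          (subset_nodes_of_mem_clusterBlocks (List.mem_cons_of_mem _ hB) h),
          hlr _ (Or.inl rfl) B (Or.inr hB), h₂.1 B hB⟩
    · rw [if_neg h, if_neg h, List.pairwise_cons, List.pairwise_append]
      exact ⟨fun _ _ => Finset.disjoint_empty_left _, h₁, h₂, hlr⟩

theorem card_rootBlock {t : PlaneTree NodeType α} (hn : t.leaves.Nodup) :
    (t.rootBlock x).card = t.rootSize x := by
  induction t with
  | leaf a => rfl
  | node y l r hl hr =>
    obtain ⟨hl', hr', -⟩ := Multiset.nodup_add.1 hn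
    rw [rootBlock, rootSize]
    split_ifs
    · rw [Finset.card_insert_of_notMem, Finset.card_union_of_disjoint, hl hl', hr hr', add_comm]
      · exact (disjoint_nodes hn).mono rootBlock_subset_nodes rootBlock_subset_nodes
      · rw [Finset.mem_union, not_or]
        exact ⟨fun h => notMem_nodes_left hn (rootBlock_subset_nodes h),
          fun h => notMem_nodes_right hn (rootBlock_subset_nodes h)⟩
    · rfl

theorem prod_clusterBlocks (f : ℕ → ℝ) {t : PlaneTree NodeType α} (hn : t.leaves.Nodup) :
    ((t.clusterBlocks x).map fun B => f B.card).prod = t.clusterProd x f := by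
  rw [clusterBlocks, List.map_cons, List.prod_cons, card_rootBlock hn, clusterProd]
  congr 1
  induction t with
  | leaf a => rfl
  | node y l r hl hr =>
    obtain ⟨hl', hr', -⟩ := Multiset.nodup_add.1 hn
    rw [lowerBlocks, lowerProd]
    split_ifs
    · rw [List.map_append, List.prod_append, hl hl', hr hr']
    · rw [List.map_append, List.prod_append, List.map_cons, List.map_cons, List.prod_cons,
        List.prod_cons, hl hl', hr hr', card_rootBlock hl', card_rootBlock hr']

theorem exists_superset_left {l r : PlaneTree NodeType α} {B : Finset (Finset α)}
    (hB : B ∈ l.clusterBlocks x) : ∃ B' ∈ (node y l r).clusterBlocks x, B ⊆ B' := by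
  rw [clusterBlocks, List.mem_cons] at hB
  rw [clusterBlocks, rootBlock, lowerBlocks]
  by_cases h : y = x
  · rw [if_pos h, if_pos h]
    rcases hB with rfl | hB
    · exact ⟨_, List.mem_cons_self, Finset.subset_union_left.trans (Finset.subset_insert _ _)⟩
    · exact ⟨B, by simp [hB], subset_rfl⟩
  · rw [if_neg h, if_neg h]
    exact ⟨B, by simp only [List.mem_cons, List.mem_append]; tauto, subset_rfl⟩

theorem exists_superset_right {l r : PlaneTree NodeType α} {B : Finset (Finset α)}
    (hB : B ∈ r.clusterBlocks x) : ∃ B' ∈ (node y l r).clusterBlocks x, B ⊆ B' := by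
  rw [clusterBlocks, List.mem_cons] at hB
  rw [clusterBlocks, rootBlock, lowerBlocks]
  by_cases h : y = x
  · rw [if_pos h, if_pos h]
    rcases hB with rfl | hB
    · exact ⟨_, List.mem_cons_self, Finset.subset_union_right.trans (Finset.subset_insert _ _)⟩
    · exact ⟨B, by simp [hB], subset_rfl⟩
  · rw [if_neg h, if_neg h]
    exact ⟨B, by simp only [List.mem_cons, List.mem_append]; tauto, subset_rfl⟩

theorem leaves_mem_rootBlock_of_mem {t : PlaneTree NodeType α} {c : Finset α}
    (hc : c ∈ t.rootBlock x) : t.leaves.toFinset ∈ t.rootBlock x := by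
  cases t with
  | leaf a => simp [rootBlock] at hc
  | node y l r =>
    rw [rootBlock] at hc ⊢
    split_ifs at hc ⊢
    · exact Finset.mem_insert_self _ _
    · simp at hc

theorem leaves_mem_rootBlock {t : PlaneTree NodeType α} (hn : t.leaves.Nodup)
    (hc : t.leaves.toFinset ∈ t.nodes x) : t.leaves.toFinset ∈ t.rootBlock x := by
  cases t with
  | leaf a => simp [nodes] at hc
  | node y l r =>
    rw [nodes, Finset.mem_union, Finset.mem_union] at hc
    rw [rootBlock]
    by_cases h : y = x
    · rw [if_pos h]
      exact Finset.mem_insert_self _ _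
    · rw [if_neg h] at hc
      exact (hc.resolve_left (Finset.notMem_empty _)).elim
        (fun h => (notMem_nodes_left hn h).elim) (fun h => (notMem_nodes_right hn h).elim)

theorem subset_of_mem_edges {t : PlaneTree NodeType α} {c d : Finset α} (h : (c, d) ∈ t.edges) :
    c ⊆ t.leaves.toFinset ∧ d ⊆ t.leaves.toFinset := by
  induction t with
  | leaf a => simp [edges] at h
  | node y l r hl hr =>
    simp only [edges, Finset.mem_union, Finset.mem_insert, Finset.mem_singleton,
      Prod.mk.injEq] at h
    rw [leaves]
    have h₁ : l.leaves.toFinset ⊆ (l.leaves + r.leaves).toFinset := by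
      rw [Multiset.toFinset_add]; exact Finset.subset_union_left
    have h₂ : r.leaves.toFinset ⊆ (l.leaves + r.leaves).toFinset := by
      rw [Multiset.toFinset_add]; exact Finset.subset_union_right
    rcases h with (⟨rfl, rfl⟩ | ⟨rfl, rfl⟩) | h | h
    · exact ⟨subset_rfl, h₁⟩
    · exact ⟨subset_rfl, h₂⟩
    · exact ⟨(hl h).1.trans h₁, (hl h).2.trans h₁⟩
    · exact ⟨(hr h).1.trans h₂, (hr h).2.trans h₂⟩

theorem mem_nodes_left {l r : PlaneTree NodeType α} (hn : (node y l r).leaves.Nodup)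
    {c : Finset α} (hc : c ∈ (node y l r).nodes x) (hs : c ⊆ l.leaves.toFinset) :
    c ∈ l.nodes x := by
  have hd := disjoint_toFinset_leaves hn
  rw [nodes, Finset.mem_union, Finset.mem_union] at hc
  rcases hc with hc | hc | hc
  · split_ifs at hc
    · rw [Finset.mem_singleton.1 hc, Multiset.toFinset_add] at hs
      obtain ⟨i, hi⟩ := leaves_toFinset_nonempty r
      exact (Finset.disjoint_left.1 hd (hs (Finset.mem_union_right _ hi)) hi).elim
    · simp at hc
  · exact hc
  · obtain ⟨h₁, i, hi⟩ := subset_of_mem_nodes hc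
    exact (Finset.disjoint_left.1 hd (hs hi) (h₁ hi)).elim

theorem mem_nodes_right {l r : PlaneTree NodeType α} (hn : (node y l r).leaves.Nodup)
    {c : Finset α} (hc : c ∈ (node y l r).nodes x) (hs : c ⊆ r.leaves.toFinset) :
    c ∈ r.nodes x := by
  have hd := disjoint_toFinset_leaves hn
  rw [nodes, Finset.mem_union, Finset.mem_union] at hc
  rcases hc with hc | hc | hc
  · split_ifs at hc
    · rw [Finset.mem_singleton.1 hc, Multiset.toFinset_add] at hs
      obtain ⟨i, hi⟩ := leaves_toFinset_nonempty l
      exact (Finset.disjoint_left.1 hd hi (hs (Finset.mem_union_left _ hi))).elim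
    · simp at hc
  · obtain ⟨h₁, i, hi⟩ := subset_of_mem_nodes hc
    exact (Finset.disjoint_left.1 hd (h₁ hi) (hs hi)).elim
  · exact hc

/-- An edge from the root joins it to the top of a child's root block, which the root block absorbs;
any other edge lies inside one subtree, whose blocks only grow when the root is added. -/
theorem exists_block_of_edge {t : PlaneTree NodeType α} (hn : t.leaves.Nodup) {c d : Finset α}
    (h : (c, d) ∈ t.edges) (hc : c ∈ t.nodes x) (hd : d ∈ t.nodes x) :
    ∃ B ∈ t.clusterBlocks x, c ∈ B ∧ d ∈ B := by
  induction t with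
  | leaf a => simp [edges] at h
  | node y l r hl hr =>
    obtain ⟨hl', hr', -⟩ := Multiset.nodup_add.1 hn
    simp only [edges, Finset.mem_union, Finset.mem_insert, Finset.mem_singleton,
      Prod.mk.injEq] at h
    have hroot : c = (l.leaves + r.leaves).toFinset → (node y l r).rootBlock x =
        insert c (l.rootBlock x ∪ r.rootBlock x) := by
      rintro rfl
      by_cases hy : y = x
      · rw [rootBlock, if_pos hy]
      · have := leaves_mem_rootBlock hn (x := x) hc
        simp [rootBlock, hy] at this
    rcases h with (⟨hcU, hdl⟩ | ⟨hcU, hdr⟩) | h | h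
    · refine ⟨_, List.mem_cons_self, ?_⟩
      rw [hroot hcU]
      have := leaves_mem_rootBlock hl' (hdl ▸ mem_nodes_left hn hd hdl.subset)
      rw [← hdl] at this
      simp [this]
    · refine ⟨_, List.mem_cons_self, ?_⟩
      rw [hroot hcU]
      have := leaves_mem_rootBlock hr' (hdr ▸ mem_nodes_right hn hd hdr.subset)
      rw [← hdr] at this
      simp [this]
    · obtain ⟨hcs, hds⟩ := subset_of_mem_edges h
      obtain ⟨B, hB, h₁, h₂⟩ := hl hl' h (mem_nodes_left hn hc hcs) (mem_nodes_left hn hd hds)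
      obtain ⟨B', hB', hs⟩ := exists_superset_left (r := r) (y := y) hB
      exact ⟨B', hB', hs h₁, hs h₂⟩
    · obtain ⟨hcs, hds⟩ := subset_of_mem_edges h
      obtain ⟨B, hB, h₁, h₂⟩ := hr hr' h (mem_nodes_right hn hc hcs) (mem_nodes_right hn hd hds)
      obtain ⟨B', hB', hs⟩ := exists_superset_right (l := l) (y := y) hB
      exact ⟨B', hB', hs h₁, hs h₂⟩

/-- The edges between nodes of type `x`. -/
def TypeEdge (x : NodeType) (t : PlaneTree NodeType α) (c d : Finset α) : Prop :=
  (c, d) ∈ t.edges ∧ c ∈ t.nodes x ∧ d ∈ t.nodes x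

theorem TypeEdge.left {l r : PlaneTree NodeType α} {c d : Finset α} (h : l.TypeEdge x c d) :
    (node y l r).TypeEdge x c d := by
  obtain ⟨h₁, h₂, h₃⟩ := h
  simp only [TypeEdge, edges, nodes, Finset.mem_union, h₁, h₂, h₃]
  tauto

theorem TypeEdge.right {l r : PlaneTree NodeType α} {c d : Finset α} (h : r.TypeEdge x c d) :
    (node y l r).TypeEdge x c d := by
  obtain ⟨h₁, h₂, h₃⟩ := h
  simp only [TypeEdge, edges, nodes, Finset.mem_union, h₁, h₂, h₃]
  tauto

theorem reflTransGen_of_mem_rootBlock {t : PlaneTree NodeType α} {c : Finset α}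
    (hc : c ∈ t.rootBlock x) : Relation.ReflTransGen (t.TypeEdge x) t.leaves.toFinset c := by
  induction t with
  | leaf a => simp [rootBlock] at hc
  | node y l r hl hr =>
    by_cases h : y = x
    · rw [rootBlock, if_pos h, Finset.mem_insert, Finset.mem_union] at hc
      rcases hc with rfl | hc | hc
      · exact .refl
      · refine .head ⟨?_, ?_, ?_⟩ (Relation.ReflTransGen.mono (fun _ _ h => h.left) _ _ (hl hc))
        · simp [edges, leaves]
        · simp [nodes, leaves, h]
        · have := rootBlock_subset_nodes (leaves_mem_rootBlock_of_mem hc)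
          simp [nodes, this]
      · refine .head ⟨?_, ?_, ?_⟩ (Relation.ReflTransGen.mono (fun _ _ h => h.right) _ _ (hr hc))
        · simp [edges, leaves]
        · simp [nodes, leaves, h]
        · have := rootBlock_subset_nodes (leaves_mem_rootBlock_of_mem hc)
          simp [nodes, this]
    · simp [rootBlock, h] at hc

/-- Every node of a block is reached downwards from the top of the block, so any two of its nodes
are joined through that top. -/
theorem exists_reflTransGen {t : PlaneTree NodeType α} {B : Finset (Finset α)}
    (hB : B ∈ t.clusterBlocks x) :
    ∃ u, ∀ c ∈ B, Relation.ReflTransGen (t.TypeEdge x) u c := by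
  rw [clusterBlocks, List.mem_cons] at hB
  rcases hB with rfl | hB
  · exact ⟨_, fun c hc => reflTransGen_of_mem_rootBlock hc⟩
  induction t with
  | leaf a => simp [lowerBlocks] at hB
  | node y l r hl hr =>
    have h : B = l.rootBlock x ∨ B ∈ l.lowerBlocks x ∨ B = r.rootBlock x ∨ B ∈ r.lowerBlocks x := by
      rw [lowerBlocks] at hB
      split_ifs at hB <;> simp only [List.mem_append, List.mem_cons] at hB <;> tauto
    rcases h with rfl | h | rfl | h
    · exact ⟨_, fun c hc =>
        Relation.ReflTransGen.mono (fun _ _ h => h.left) _ _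
          (reflTransGen_of_mem_rootBlock hc)⟩
    · obtain ⟨u, hu⟩ := hl h
      exact ⟨u, fun c hc => Relation.ReflTransGen.mono (fun _ _ h => h.left) _ _ (hu c hc)⟩
    · exact ⟨_, fun c hc =>
        Relation.ReflTransGen.mono (fun _ _ h => h.right) _ _
          (reflTransGen_of_mem_rootBlock hc)⟩
    · obtain ⟨u, hu⟩ := hr h
      exact ⟨u, fun c hc => Relation.ReflTransGen.mono (fun _ _ h => h.right) _ _ (hu c hc)⟩

end ClusterBlocks

end PlaneTree

/-! ### Clusters of a decomposition tree read off a drawing. -/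

namespace BDT

variable {α : Type*} [DecidableEq α] {o : Finset α}

open PlaneTree

/-- Products over the clusters of a BDT in terms of a plane drawing. -/
theorem prod_cluster (T : BDT o) (t : PlaneTree NodeType α) {x : NodeType}
    [Fintype (T.Cluster x)]
    (hN : T.nodes x = t.nodes x) (hE : T.edges = t.edges) (hn : t.leaves.Nodup) {f : ℕ → ℝ}
    (hf : f 0 = 1) :
    ∏ C : T.Cluster x, f (clusterSize C) = t.clusterProd x f := by
  rw [← prod_clusterBlocks f hn]
  have hadj : ∀ c d, (T.typeGraph x).Adj c d ↔
      c ≠ d ∧ ((c.1, d.1) ∈ t.edges ∨ (d.1, c.1) ∈ t.edges) := by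
    intro c d
    rw [← hE]
    exact SimpleGraph.fromRel_adj _ _ _
  have hmem : ∀ c, c ∈ T.nodes x ↔ c ∈ t.nodes x := fun c => by rw [hN]
  refine prod_components (T.typeGraph x) hf _ (clusterBlocks_pairwise hn)
    (fun c => (hmem c).trans mem_nodes_iff) ?_ ?_
  · intro c d h
    rcases ((hadj c d).1 h).2 with h | h
    · exact exists_block_of_edge hn h ((hmem _).1 c.2) ((hmem _).1 d.2)
    · obtain ⟨B, hB, h₁, h₂⟩ := exists_block_of_edge hn h ((hmem _).1 d.2) ((hmem _).1 c.2)
      exact ⟨B, hB, h₂, h₁⟩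
  · intro B hB c d hc hd
    obtain ⟨u, hu⟩ := exists_reflTransGen hB
    -- Vertices of the graph are nodes with a membership proof, so the walk is built backwards from
    -- `c`, together with the membership of its start.
    have key : ∀ u c, Relation.ReflTransGen (t.TypeEdge x) u c → ∀ hc : c ∈ T.nodes x,
        ∃ hu : u ∈ T.nodes x, (T.typeGraph x).Reachable ⟨u, hu⟩ ⟨c, hc⟩ := by
      intro u c h
      induction h using Relation.ReflTransGen.head_induction_on with
      | refl => exact fun hc => ⟨hc, .refl _⟩
      | head h _ ih =>
        intro hc
        obtain ⟨hu, hr⟩ := ih hc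
        refine ⟨(hmem _).2 h.2.1, SimpleGraph.Reachable.trans ?_ hr⟩
        by_cases he : (⟨_, (hmem _).2 h.2.1⟩ : {c // c ∈ T.nodes x}) = ⟨_, hu⟩
        · rw [he]
        · exact SimpleGraph.Adj.reachable ((hadj _ _).2 ⟨he, Or.inl h.1⟩)
    obtain ⟨hu₁, h₁⟩ := key u c (hu c hc) c.2
    obtain ⟨_, h₂⟩ := key u d (hu d hd) d.2
    exact h₁.symm.trans h₂

end BDT

open PlaneTree

/-! ### Counting topologies and summing over node types. -/

section Topologies

variable {α : Type*}

open Nat in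
-- All nodes are unordered and weigh `1/2`, so the power of `2 * ∑ w` in `sum_weight` is `1`.
theorem card_topology {o : Finset α} (ho : o.Nonempty) :
    Fintype.card (Topology o) = (2 * o.card - 3)‼ := by
  have h := sum_treeOn (fun _ : Unit => False) (o := o) (fun _ => 1) (fun _ => 1) fun _ _ => rfl
  simp only [if_false, mul_one] at h
  rw [sum_weight _ ho] at h
  simp only [Finset.sum_const, Finset.card_univ, nsmul_eq_mul, mul_one, Fintype.card_unit,
    Nat.cast_one, one_mul] at h
  rw [show (2 : ℝ) * (1 / 2) = 1 by norm_num, one_pow, one_mul] at h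
  exact_mod_cast h

/-- Summing over the types of the nodes of a given shape. -/
theorem sum_weight_shape {L : Type*} [Fintype L] [DecidableEq α] (w : L → ℝ) (A : Finset α)
    (Γ : PlaneTree Unit α → ℝ) :
    ∑ s ∈ planeTrees L A, s.weight w * Γ s.shape =
      ∑ s ∈ planeTrees Unit A, s.weight (fun _ => ∑ x, w x) * Γ s := by
  induction A using Finset.strongInduction generalizing Γ with
  | H A ih =>
  rcases Nat.lt_or_ge A.card 2 with hc | hc
  · obtain hc | hc : A.card = 0 ∨ A.card = 1 := by omega
    · simp [Finset.card_eq_zero.1 hc, planeTrees_empty]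
    · obtain ⟨a, rfl⟩ := Finset.card_eq_one.1 hc
      simp [planeTrees_singleton, weight, shape]
  rw [sum_planeTrees hc, sum_planeTrees hc, Fintype.sum_unique (ι := Unit), Finset.sum_comm]
  refine Finset.sum_congr rfl fun B hB => ?_
  rw [Finset.mem_powerset] at hB
  by_cases h₁ : B = A
  · simp [h₁, planeTrees_empty]
  by_cases h₂ : B = ∅
  · simp [h₂, planeTrees_empty]
  have ihl := ih B (hB.ssubset_of_ne h₁)
  have ihr := ih (A \ B) (Finset.sdiff_ssubset hB (Finset.nonempty_iff_ne_empty.2 h₂))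
  calc ∑ x, ∑ l ∈ planeTrees L B, ∑ r ∈ planeTrees L (A \ B),
        (node x l r).weight w * Γ (node x l r).shape
      = ∑ x, ∑ l ∈ planeTrees L B, l.weight w * (w x * ∑ r ∈ planeTrees L (A \ B),
          r.weight w * Γ (node () l.shape r.shape)) := by
        refine Finset.sum_congr rfl fun x _ => Finset.sum_congr rfl fun l _ => ?_
        rw [Finset.mul_sum, Finset.mul_sum]
        refine Finset.sum_congr rfl fun r _ => ?_
        rw [weight, shape]
        ring
    _ = ∑ x, ∑ l ∈ planeTrees Unit B, l.weight (fun _ => ∑ x, w x) * (w x *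
          ∑ r ∈ planeTrees Unit (A \ B), r.weight (fun _ => ∑ x, w x) * Γ (node () l r)) := by
        refine Finset.sum_congr rfl fun x _ => ?_
        rw [← ihl (fun l => w x * ∑ r ∈ planeTrees Unit (A \ B),
          r.weight (fun _ => ∑ x, w x) * Γ (node () l r))]
        refine Finset.sum_congr rfl fun l _ => ?_
        rw [← ihr (fun r => Γ (node () l.shape r))]
    _ = _ := by
        rw [Finset.sum_comm]
        refine Finset.sum_congr rfl fun l _ => ?_
        rw [← Finset.mul_sum, ← Finset.sum_mul, Finset.mul_sum, Finset.mul_sum]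
        refine Finset.sum_congr rfl fun r _ => ?_
        rw [weight, show (default : Unit) = () from rfl]
        ring

end Topologies

/-! ### The priors as weighted sums over plane trees. -/

section Prior

variable {α : Type*} [DecidableEq α] {q : ℝ} {o : Finset α}

/-- The weights of the node types of a plane tree under the prior. -/
noncomputable def nodeWeight (q : ℝ) : NodeType → ℝ
  | .S => q / 2
  | .P => (1 - q) / 2

theorem sum_nodeWeight (q : ℝ) : ∑ x, nodeWeight q x = 1 / 2 := by
  have : (Finset.univ : Finset NodeType) = {.S, .P} := rfl
  rw [this, Finset.sum_pair (by simp), nodeWeight, nodeWeight]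
  ring

open Nat in
-- The truncated exponent in the definition counts the `P`-nodes, as there are `n - 1` internal
-- nodes.
theorem treePrior_eq (ho : o.Nonempty) (t : BDT o) :
    treePrior q t = 1 / ((2 * o.card - 3)‼ : ℝ) * (q / 2) ^ (t.nodes NodeType.S).card *
      (1 - q) ^ (t.nodes NodeType.P).card := by
  have h : (t.nodes .S).card + (t.nodes .P).card = o.card - 1 := by
    obtain ⟨t, ht⟩ := t
    induction t using Quotient.inductionOn with
    | h t =>
    change t.leaves = o.val at ht
    have := card_nodes_add (t := t) (ht ▸ o.nodup)
    rwa [ht] at this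
  rw [treePrior, card_topology ho, show o.card - (t.nodes .S).card - 1 = (t.nodes .P).card by omega]

open Nat in
theorem treePrior_mk (ho : o.Nonempty) (s : PlaneTree NodeType α) (hs : s.leaves = o.val) :
    treePrior q (⟨Quotient.mk (setoid _ α) s, hs⟩ : BDT o) = 1 / ((2 * o.card - 3)‼ : ℝ) *
      s.weight (fun x => if x = NodeType.S then q / 2 else 1 - q) := by
  have hn : s.leaves.Nodup := hs ▸ o.nodup
  refine (treePrior_eq ho _).trans ?_
  rw [mul_assoc]
  change _ * ((q / 2) ^ (s.nodes .S).card * (1 - q) ^ (s.nodes .P).card) = _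
  rw [← weight_eq_pow_card_nodes _ _ hn, ← weight_eq_pow_card_nodes _ _ hn, weight_mul]
  congr 2
  funext x
  cases x <;> simp

open Nat Classical in
theorem sum_treePrior (ho : o.Nonempty) (g : BDT o → ℝ) (g' : PlaneTree NodeType α → ℝ)
    (h : ∀ s (hs : s.leaves = o.val), g ⟨Quotient.mk (setoid _ α) s, hs⟩ = g' s) :
    ∑ t : BDT o, treePrior q t * g t = 1 / ((2 * o.card - 3)‼ : ℝ) *
      ∑ s ∈ planeTrees NodeType o, s.weight (nodeWeight q) * g' s := by
  rw [sum_treeOn (fun x => x = NodeType.S) (fun t : BDT o => treePrior q t * g t)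
    (fun s => 1 / ((2 * o.card - 3)‼ : ℝ) *
      s.weight (fun x => if x = NodeType.S then q / 2 else 1 - q) * g' s), Finset.mul_sum]
  · refine Finset.sum_congr rfl fun s _ => ?_
    -- The drawing factor `1/2` falls on `P`-nodes only; the `1/2` at `S`-nodes is the fair coin.
    have : s.weight (nodeWeight q) = s.weight (fun x => if x = NodeType.S then 1 else 1 / 2) *
        s.weight (fun x => if x = NodeType.S then q / 2 else 1 - q) := by
      rw [weight_mul]
      congr 1
      funext x
      cases x <;> simp [nodeWeight]
      ring
    rw [this]
    ring_nf
  · intro s hs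
    rw [treePrior_mk ho, h]

open Nat in
-- Summing out the type of a node leaves `1/2`, exactly the weight with which an untyped tree is
-- spread over its drawings. What remains is the indicator of `τ`, summed over topologies.
theorem topologyMarginal_eq (ho : o.Nonempty) (τ : Topology o) :
    topologyMarginal q τ = 1 / ((2 * o.card - 3)‼ : ℝ) := by
  classical
  have h₁ := sum_treePrior (q := q) ho (fun t => if t.topology = τ then 1 else 0)
    (fun s => if Quotient.mk (setoid _ α) s.shape = τ.1 then 1 else 0) (by
      intro s hs
      exact if_congr Subtype.ext_iff rfl rfl)
  have h₂ := sum_treeOn (fun _ : Unit => False) (o := o) (fun σ => if σ = τ then 1 else 0)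
    (fun s => if Quotient.mk (setoid _ α) s = τ.1 then 1 else 0) (by
      intro s hs
      exact if_congr Subtype.ext_iff rfl rfl)
  have h₃ := sum_weight_shape (nodeWeight q) o
    (fun s => if Quotient.mk (setoid _ α) s = τ.1 then 1 else 0)
  rw [sum_nodeWeight] at h₃
  simp only [if_false] at h₂
  rw [h₃, ← h₂] at h₁
  simp only [mul_ite, mul_one, mul_zero] at h₁
  rw [Finset.sum_ite_eq' Finset.univ τ, if_pos (Finset.mem_univ _), mul_one] at h₁
  rw [← h₁, topologyMarginal, Finset.sum_filter]

/-- The expectation of `g` under the prior on orders with ground set `o`. -/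
noncomputable def expectation (q : ℝ) (o : Finset α) (g : GroundRel α → ℝ) : ℝ :=
  1 / ((2 * o.card - 3).doubleFactorial : ℝ) *
    ∑ s ∈ planeTrees NodeType o, s.weight (nodeWeight q) * g s.toRel

open Classical in
theorem vspPrior_eq_expectation (ho : o.Nonempty) (v : VSP o) :
    vspPrior q o v = expectation q o (fun h => if h = v.1 then 1 else 0) := by
  have h := sum_treePrior (q := q) ho (fun t => if t.toVSP = v then 1 else 0)
    (fun s => if s.toRel = v.1 then 1 else 0) (by
      intro s hs
      exact if_congr Subtype.ext_iff rfl rfl)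
  rw [vspPrior, expectation, ← h, Finset.sum_filter]
  exact Finset.sum_congr rfl fun t _ => by split_ifs <;> simp

theorem toRel_mem {s : PlaneTree NodeType α} (hs : s ∈ planeTrees NodeType o) :
    IsVSP s.toRel ∧ s.toRel.ground = o := by
  rw [mem_planeTrees] at hs
  exact ⟨s.toRel_isVSP (hs ▸ o.nodup), by rw [toRel_ground, hs, Finset.val_toFinset]⟩

theorem sum_vspPrior_mul (ho : o.Nonempty) (g : GroundRel α → ℝ) :
    ∑ v : VSP o, vspPrior q o v * g v.1 = expectation q o g := by
  classical
  simp only [vspPrior_eq_expectation ho, expectation, mul_assoc, ← Finset.mul_sum,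
    Finset.sum_mul]
  rw [Finset.sum_comm]
  congr 1
  refine Finset.sum_congr rfl fun s hs => ?_
  rw [← Finset.mul_sum]
  congr 1
  refine (Finset.sum_eq_single (⟨s.toRel, toRel_mem hs⟩ : VSP o) (fun v _ hne => ?_) ?_).trans ?_
  · rw [if_neg fun h => hne (Subtype.ext h.symm), zero_mul]
  · exact fun h => (h (Finset.mem_univ (α := VSP o) _)).elim
  · simp

/-! ### Restriction of orders and projectivity. -/

theorem GroundRel.restrict_series (h₁ h₂ : GroundRel α) (o : Finset α) :
    (h₁.series h₂).restrict o = (h₁.restrict o).series (h₂.restrict o) := by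
  refine GroundRel.ext (Finset.union_inter_distrib_right _ _ _) ?_
  funext i j
  simp only [GroundRel.restrict, GroundRel.series, Finset.mem_inter]
  grind

theorem GroundRel.restrict_parallel (h₁ h₂ : GroundRel α) (o : Finset α) :
    (h₁.parallel h₂).restrict o = (h₁.restrict o).parallel (h₂.restrict o) := by
  refine GroundRel.ext (Finset.union_inter_distrib_right _ _ _) ?_
  funext i j
  simp only [GroundRel.restrict, GroundRel.parallel]
  grind

theorem GroundRel.restrict_single_of_notMem {z : α} (hz : z ∉ o) :
    (GroundRel.single z).restrict o = ⟨∅, fun _ _ => False⟩ := by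
  refine GroundRel.ext (Finset.singleton_inter_of_notMem hz) ?_
  funext i j
  simp [GroundRel.restrict, GroundRel.single]

theorem IsVSP.restrict_ground {h : GroundRel α} (hv : IsVSP h) : h.restrict h.ground = h := by
  refine GroundRel.ext (Finset.inter_self _) ?_
  funext i j
  exact propext ⟨fun hij => hij.1, fun hij => ⟨hij, hv.supp i j hij⟩⟩

/-- Series or parallel composition. -/
def compose : NodeType → GroundRel α → GroundRel α → GroundRel α
  | .S => GroundRel.series
  | .P => GroundRel.parallel

/-- Restriction to `o` commutes with both compositions and turns the leaf `z` into the empty order,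
neutral for both. The insertion factor `(2n - 1) * 2 * (1/2)` cancels against the normalising
constants. -/
theorem expectation_restrict_insert {A : Finset α} {z : α} (hA : A.Nonempty) (hz : z ∉ A)
    (hzo : z ∉ o) (g : GroundRel α → ℝ) :
    expectation q (insert z A) (fun h => g (h.restrict o)) =
      expectation q A (fun h => g (h.restrict o)) := by
  have key := sum_weight_insert (nodeWeight q) (z := z)
    (fun t : PlaneTree NodeType α => t.toRel.restrict o) compose
    (fun x l r => by
      cases x
      · exact GroundRel.restrict_series _ _ _
      · exact GroundRel.restrict_parallel _ _ _)
    (fun x b => by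
      rw [toRel, GroundRel.restrict_single_of_notMem hzo]
      cases x <;> refine GroundRel.ext (Finset.empty_union _) ?_ <;> funext i j <;>
        simp [compose, GroundRel.series, GroundRel.parallel])
    (fun x b => by
      rw [toRel, GroundRel.restrict_single_of_notMem hzo]
      cases x <;> refine GroundRel.ext (Finset.union_empty _) ?_ <;> funext i j <;>
        simp [compose, GroundRel.series, GroundRel.parallel])
    hA hz g
  have hpos : (2 * (A.card : ℝ) - 1) ≠ 0 := by
    have : (1 : ℝ) ≤ A.card := by exact_mod_cast hA.card_pos
    linarith
  rw [expectation, key, expectation, sum_nodeWeight, Finset.card_insert_of_notMem hz,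
    doubleFactorial_step hA.card_pos]
  have : ((2 * A.card - 3).doubleFactorial : ℝ) ≠ 0 := by
    exact_mod_cast (Nat.doubleFactorial_pos _).ne'
  field_simp

theorem expectation_restrict (ho : o.Nonempty) {o' : Finset α} (hoo : o ⊆ o')
    (g : GroundRel α → ℝ) :
    expectation q o' (fun h => g (h.restrict o)) = expectation q o g := by
  obtain ⟨D, rfl⟩ : ∃ D, o' = o ∪ D := ⟨o', (Finset.union_eq_right.2 hoo).symm⟩
  clear hoo
  induction D using Finset.induction_on with
  | empty =>
    rw [Finset.union_empty, expectation, expectation]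
    congr 1
    refine Finset.sum_congr rfl fun s hs => ?_
    obtain ⟨h₁, h₂⟩ := toRel_mem hs
    have := h₁.restrict_ground
    rw [h₂] at this
    rw [this]
  | insert z D hz ih =>
    rw [Finset.union_insert]
    by_cases h : z ∈ o ∪ D
    · rw [Finset.insert_eq_of_mem h, ih]
    · rw [expectation_restrict_insert (ho.mono Finset.subset_union_left) h
        (fun hzo => h (Finset.mem_union_left _ hzo)), ih]

theorem marginallyConsistent_vspPrior (q : ℝ) :
    MarginallyConsistent (fun o : Finset α => vspPrior q o) := by
  classical
  intro o o' ho hoo w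
  have h := sum_vspPrior_mul (q := q) (ho.mono hoo)
    (fun h => if h.restrict o = w.1 then 1 else 0)
  rw [expectation_restrict ho hoo (fun h => if h = w.1 then 1 else 0)] at h
  change vspPrior q o w = ∑ v : VSP o' with v.1.restrict o = w.1, vspPrior q o' v
  rw [vspPrior_eq_expectation ho, Finset.sum_filter]
  simp only [mul_ite, mul_one, mul_zero] at h
  rw [h]

theorem sum_vspPrior (q : ℝ) (ho : o.Nonempty) : ∑ v : VSP o, vspPrior q o v = 1 := by
  have h := sum_vspPrior_mul (q := q) ho (fun _ => 1)
  simp only [mul_one, expectation] at h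
  rw [h, sum_weight _ ho, sum_nodeWeight]
  have : ((2 * o.card - 3).doubleFactorial : ℝ) ≠ 0 := by
    exact_mod_cast (Nat.doubleFactorial_pos _).ne'
  simp [this]

theorem vspPrior_nonneg (hq₀ : 0 ≤ q) (hq₁ : q ≤ 1) (v : VSP o) : 0 ≤ vspPrior q o v := by
  refine Finset.sum_nonneg fun t _ => ?_
  have : 0 ≤ 1 - q := by linarith
  rw [treePrior]
  positivity

/-! ### Existence of trees and the closed form. -/

theorem IsVSP.exists_planeTree {h : GroundRel α} (hv : IsVSP h) :
    ∃ t : PlaneTree NodeType α, t.toRel = h ∧ t.leaves = h.ground.val := by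
  induction hv with
  | single a => exact ⟨leaf a, rfl, rfl⟩
  | series hd _ _ ih₁ ih₂ =>
    obtain ⟨l, rfl, hl⟩ := ih₁
    obtain ⟨r, rfl, hr⟩ := ih₂
    refine ⟨node .S l r, rfl, ?_⟩
    rw [leaves, hl, hr]
    exact congrArg Finset.val (Finset.disjUnion_eq_union _ _ hd)
  | parallel hd _ _ ih₁ ih₂ =>
    obtain ⟨l, rfl, hl⟩ := ih₁
    obtain ⟨r, rfl, hr⟩ := ih₂
    refine ⟨node .P l r, rfl, ?_⟩
    rw [leaves, hl, hr]
    exact congrArg Finset.val (Finset.disjUnion_eq_union _ _ hd)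

theorem exists_toVSP_eq (v : VSP o) : ∃ t : BDT o, t.toVSP = v := by
  obtain ⟨v, hv, rfl⟩ := v
  obtain ⟨t, rfl, ht⟩ := hv.exists_planeTree
  exact ⟨⟨Quotient.mk _ t, ht⟩, rfl⟩

/-- Comparing on leaves suffices, since both orders are supported on `o`. -/
theorem toRel_eq_iff_represents {s : PlaneTree NodeType α} (hs : s ∈ planeTrees NodeType o)
    (v : VSP o) : s.toRel = v.1 ↔ Represents v.1.above s := by
  obtain ⟨h₁, h₂⟩ := toRel_mem hs
  rw [mem_planeTrees] at hs
  unfold Represents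
  constructor
  · intro h i _ j _
    rw [h]
  · intro h
    refine GroundRel.ext (h₂.trans v.2.2.symm) ?_
    funext i j
    by_cases hij : i ∈ o ∧ j ∈ o
    · exact propext (h i (by rw [hs]; exact hij.1) j (by rw [hs]; exact hij.2))
    · have n₁ : ¬ s.toRel.above i j := fun h' => hij (h₂ ▸ h₁.supp i j h')
      have n₂ : ¬ v.1.above i j := fun h' => hij (v.2.2 ▸ v.2.1.supp i j h')
      simp [n₁, n₂]

theorem vspPrior_eq_repSum (ho : o.Nonempty) (v : VSP o) :
    vspPrior q o v = 1 / ((2 * o.card - 3).doubleFactorial : ℝ) *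
      repSum (nodeWeight q) v.1.above o := by
  classical
  rw [vspPrior_eq_expectation ho, expectation, repSum]
  congr 1
  refine Finset.sum_congr rfl fun s hs => ?_
  rw [if_congr (toRel_eq_iff_represents hs v) rfl rfl, mul_ite, mul_one, mul_zero]

theorem catalanNumber_eq (s : ℕ) : catalanNumber s = catalan s := by
  have h := succ_mul_catalan_eq_centralBinom s
  rw [Nat.centralBinom_eq_two_mul_choose] at h
  have h' : ((s : ℝ) + 1) * catalan s = ((2 * s).choose s : ℝ) := by exact_mod_cast h
  have : (s : ℝ) + 1 ≠ 0 := by positivity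
  rw [catalanNumber, ← h']
  field_simp

open Nat in
theorem vspPrior_eq (ho : o.Nonempty) (t : BDT o) [Fintype (t.Cluster .P)]
    [Fintype (t.Cluster .S)] :
    vspPrior q o t.toVSP = treePrior q t *
      (∏ C : t.Cluster NodeType.P, ((2 * BDT.clusterSize C - 1)‼ : ℝ)) *
      ∏ C : t.Cluster NodeType.S, catalanNumber (BDT.clusterSize C) := by
  obtain ⟨s, hs, hst⟩ : ∃ (s : PlaneTree NodeType α) (hs : s.leaves = o.val),
      t = ⟨Quotient.mk (setoid _ α) s, hs⟩ := by
    obtain ⟨t, ht⟩ := t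
    induction t using Quotient.inductionOn with
    | h t => exact ⟨t, ht, rfl⟩
  have hn : s.leaves.Nodup := hs ▸ o.nodup
  have hN : ∀ x, t.nodes x = s.nodes x := by subst hst; exact fun _ => rfl
  have hE : t.edges = s.edges := by subst hst; rfl
  have hrel : t.toVSP.1 = s.toRel := by subst hst; rfl
  rw [BDT.prod_cluster t s (f := fun m => ((2 * m - 1)‼ : ℝ)) (hN _) hE hn (by simp),
    BDT.prod_cluster t s (f := catalanNumber) (hN _) hE hn (by simp [catalanNumber]),
    vspPrior_eq_repSum ho, hrel]
  -- The order is the one drawn by `s`, so `s` represents it trivially.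
  have hr := repSum_leaves (s.toRel_isVSP hn).isStrictOrder (nodeWeight q) _ s le_rfl hn
    (fun _ _ _ _ => Iff.rfl)
  -- The factor `2` per node for the plane arrangements cancels the `1/2` in `nodeWeight`.
  have hP : clusterWeight (nodeWeight q) .P = fun m => (1 - q) ^ m * ((2 * m - 1)‼ : ℝ) := by
    funext m
    rw [clusterWeight, arrangements, nodeWeight, mul_div_cancel₀ _ (by norm_num)]
  have hS : clusterWeight (nodeWeight q) .S = fun m => (q / 2) ^ m * catalanNumber m := by
    funext m
    rw [clusterWeight, arrangements, nodeWeight, catalanNumber_eq]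
  rw [hs, Finset.val_toFinset, hP, hS, clusterProd_pow_mul, clusterProd_pow_mul,
    weight_eq_pow_card_nodes _ _ hn, weight_eq_pow_card_nodes _ _ hn] at hr
  rw [hr, treePrior_eq ho, hN, hN]
  ring

end Prior

end VSPPrior

open VSPPrior Nat in
theorem theorem1 {α : Type*} [DecidableEq α] (q : ℝ) (hq₀ : 0 ≤ q) (hq₁ : q ≤ 1) :
    -- the prior on BDTs: uniform on the `(2n-3)!!` topologies, with its explicit mass function
    (∀ o : Finset α, o.Nonempty →
      Fintype.card (Topology o) = (2 * o.card - 3)‼ ∧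
      (∀ τ : Topology o, topologyMarginal q τ = 1 / ((2 * o.card - 3)‼ : ℝ)) ∧
      ∀ t : BDT o, treePrior q t =
        1 / ((2 * o.card - 3)‼ : ℝ) * (q / 2) ^ (t.nodes NodeType.S).card *
          (1 - q) ^ (t.nodes NodeType.P).card) ∧
    -- the priors on VSPs are probability distributions and are marginally consistent
    (∀ o : Finset α, o.Nonempty →
      (∀ v : VSP o, 0 ≤ vspPrior q o v) ∧ ∑ v : VSP o, vspPrior q o v = 1) ∧
    MarginallyConsistent (fun o : Finset α => vspPrior q o) ∧
    -- the closed form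
    (∀ o : Finset α, o.Nonempty → ∀ v : VSP o,
      (∃ t : BDT o, t.toVSP = v) ∧
      ∀ t : BDT o, t.toVSP = v →
        vspPrior q o v = treePrior q t *
          (∏ C : t.Cluster NodeType.P, ((2 * BDT.clusterSize C - 1)‼ : ℝ)) *
          ∏ C : t.Cluster NodeType.S, catalanNumber (BDT.clusterSize C)) := by
  refine ⟨fun o ho => ⟨card_topology ho, topologyMarginal_eq ho, treePrior_eq ho⟩,
    fun o ho => ⟨vspPrior_nonneg hq₀ hq₁, sum_vspPrior q ho⟩,
    marginallyConsistent_vspPrior q, fun o ho v => ⟨exists_toVSP_eq v, ?_⟩⟩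
  rintro t rfl
  exact vspPrior_eq ho t
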